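/- Let $n\ge 2$ be an integer. Let $\mathcal O_n$ be the Cuntz algebra, i.e. the universal unital $C^*$-algebra generated by isometries $S_1,\dots,S_n$ with $\sum_{i=1}^n S_iS_i^*=1$. For a finite word $\mu=\mu_1\cdots\mu_k$ in the letters $1,\dots,n$ put $S_\mu=S_{\mu_1}\cdots S_{\mu_k}$ (with $S_\emptyset=1$) and $P_\mu=S_\mu S_\mu^*$. Let - $\mathcal F_n$ be the norm closure of $\bigcup_{k\ge 0}\operatorname{span}\{S_\mu S_\nu^* : |\mu|=|\nu|=k\}$; - $\mathcal D_n$ be the $C^*$-subalgebra of $\mathcal O_n$ generated by all the projections $P_\mu$; - $\mathcal S_n$ be the set of unitaries in $\mathcal O_n$ of the form $\sum_{(\alpha,\beta)\in\mathcal J}S_\alpha S_\beta^*$ with $\mathcal J$ a finite set of pairs of words. For a unitary $u\in\mathcal O_n$ let $\lambda_u$ be the unital $*$-endomorphism of $\mathcal O_n$ with $\lambda_u(S_i)=uS_i$ for $i=1,\dots,n$. Let $\mathrm{Aut}(\mathcal O_n)\lambda(\mathcal F_n)$ be the set of all endomorphisms $\psi\circ\lambda_w$ with $\psi$ a $*$-automorphism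 of $\mathcal O_n$ and $w$ a unitary in $\mathcal F_n$. **Proposition 5.1.** (a) For every $n\ge 2$ there exists a unitary $u\in\mathcal S_n$ such that $\lambda_u\notin\mathrm{Aut}(\mathcal O_n)\lambda(\mathcal F_n)$. (b) For every $n\ge 2$, every unitary $w\in\mathcal F_n$ and every nonzero projection $Q\in\mathcal O_n$, the vector space $\lambda_w(\mathcal D_n)Q=\{\lambda_w(d)Q : d\in\mathcal D_n\}$ is infinite-dimensional. (c) There exists a unitary $u\in\mathcal S_2$ such that $\lambda_u(\mathcal D_2)P_2$ is one-dimensional. -/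

import Mathlib

open scoped ENNReal

noncomputable section

/-- A Cuntz family: `n` isometries in a nonzero unital C*-algebra whose range projections add
up to the identity. -/
structure CuntzFamily (n : ℕ) : Type 1 where
  carrier : Type
  [cstar : CStarAlgebra carrier]
  [nontriv : Nontrivial carrier]
  gen : Fin n → carrier
  star_gen_mul_gen : ∀ i, star (gen i) * gen i = 1
  sum_gen_mul_star : ∑ i, gen i * star (gen i) = 1

attribute [instance] CuntzFamily.cstar CuntzFamily.nontriv

/-- The C*-algebra of bounded functions assigning to each Cuntz family an element of the
C*-algebra that carries it. -/
abbrev CuntzAmbient (n : ℕ) : Type 1 := lp (fun T : CuntzFamily n => T.carrier) ∞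

instance CuntzAmbient.instCStarAlgebra (n : ℕ) : CStarAlgebra (CuntzAmbient n) where

/-- Isometries have norm one. -/
theorem CuntzFamily.norm_gen {n : ℕ} (T : CuntzFamily n) (i : Fin n) : ‖T.gen i‖ = 1 := by
  have h := CStarRing.norm_star_mul_self (x := T.gen i)
  rw [T.star_gen_mul_gen i, norm_one] at h
  nlinarith [norm_nonneg (T.gen i)]

/-- The universal Cuntz family: the `i`-th generator takes the value `Tᵢ` at the family `T`. -/
def CuntzAmbient.gen {n : ℕ} (i : Fin n) : CuntzAmbient n :=
  ⟨fun T => T.gen i, memℓp_infty ⟨1, by rintro _ ⟨T, rfl⟩; exact (T.norm_gen i).le⟩⟩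

/-- The C*-subalgebra generated by the universal Cuntz family. -/
def cuntzSubalgebra (n : ℕ) : StarSubalgebra ℂ (CuntzAmbient n) :=
  (StarAlgebra.adjoin ℂ (Set.range (CuntzAmbient.gen (n := n)))).topologicalClosure

/-- The Cuntz algebra `𝒪ₙ`: the universal C*-algebra generated by `n` isometries
`S₁, …, Sₙ` with `∑ᵢ Sᵢ Sᵢ* = 1`.  The norm of a *-polynomial in the generators is the supremum
of its norms over all Cuntz families.  (Every C*-algebra generated by a Cuntz family has at most
the cardinality of the continuum, so carriers in `Type` suffice.) -/
def CuntzAlgebra (n : ℕ) : Type 1 := cuntzSubalgebra n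

namespace CuntzAlgebra

instance instCStarAlgebra (n : ℕ) : CStarAlgebra (CuntzAlgebra n) :=
  StarSubalgebra.cstarAlgebra (cuntzSubalgebra n)
    (h_closed := StarSubalgebra.isClosed_topologicalClosure _)

/-- The identification of `𝒪ₙ` with the subalgebra that it is defined as. -/
def toSubalgebra (n : ℕ) : CuntzAlgebra n ≃⋆ₐ[ℂ] cuntzSubalgebra n where
  toFun x := x
  invFun x := x
  left_inv _ := rfl
  right_inv _ := rfl
  map_add' _ _ := rfl
  map_mul' _ _ := rfl
  map_star' _ := rfl
  map_smul' _ _ := rfl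

theorem norm_toSubalgebra {n : ℕ} (x : CuntzAlgebra n) : ‖toSubalgebra n x‖ = ‖x‖ := rfl

attribute [irreducible] instCStarAlgebra CuntzAlgebra

/-- The canonical generating isometries; the letters `1, …, n` are `0, …, n - 1` in `Fin n`. -/
def S {n : ℕ} (i : Fin n) : CuntzAlgebra n :=
  (toSubalgebra n).symm ⟨CuntzAmbient.gen i, StarSubalgebra.le_topologicalClosure _
    (StarAlgebra.subset_adjoin ℂ _ ⟨i, rfl⟩)⟩

/-- The representation of `𝒪ₙ` given by a Cuntz family. -/
def eval {n : ℕ} (T : CuntzFamily n) : CuntzAlgebra n →⋆ₐ[ℂ] T.carrier where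
  toFun x := (toSubalgebra n x : CuntzAmbient n) T
  map_one' := by rw [map_one]; rfl
  map_mul' _ _ := by rw [map_mul]; rfl
  map_zero' := by rw [map_zero]; rfl
  map_add' _ _ := by rw [map_add]; rfl
  commutes' c := by rw [AlgHomClass.commutes (toSubalgebra n)]; rfl
  map_star' _ := by rw [map_star]; rfl

theorem eval_S {n : ℕ} (T : CuntzFamily n) (i : Fin n) : eval T (S i) = T.gen i := by
  have h : (toSubalgebra n (S i) : CuntzAmbient n) = CuntzAmbient.gen i :=
    congrArg Subtype.val (StarAlgEquiv.apply_symm_apply (toSubalgebra n) _)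
  exact congrFun (congrArg Subtype.val h) T

theorem ext_eval {n : ℕ} {x y : CuntzAlgebra n} (h : ∀ T, eval T x = eval T y) : x = y :=
  (toSubalgebra n).injective (Subtype.ext (lp.ext (funext h)))

theorem star_S_mul_S {n : ℕ} (i : Fin n) : star (S i) * S i = 1 :=
  ext_eval fun T => by simp [map_star, eval_S, T.star_gen_mul_gen]

theorem sum_S_mul_star (n : ℕ) : ∑ i : Fin n, S i * star (S i) = 1 :=
  ext_eval fun T => by simp [map_star, eval_S, T.sum_gen_mul_star]

theorem continuous_toSubalgebra_symm (n : ℕ) : Continuous (toSubalgebra n).symm :=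
  AddMonoidHomClass.continuous_of_bound _ 1 fun x => by
    rw [one_mul, ← norm_toSubalgebra, StarAlgEquiv.apply_symm_apply]

/-- The isometries `S₁, …, Sₙ` generate `𝒪ₙ`. -/
theorem adjoin_S_topologicalClosure (n : ℕ) :
    (StarAlgebra.adjoin ℂ (Set.range (S (n := n)))).topologicalClosure = ⊤ := by
  let ψ : CuntzAlgebra n →⋆ₐ[ℂ] CuntzAmbient n :=
    (cuntzSubalgebra n).subtype.comp
      (toSubalgebra n : CuntzAlgebra n →⋆ₐ[ℂ] cuntzSubalgebra n)
  have hiso : Isometry ψ := AddMonoidHomClass.isometry_of_norm ψ fun x => norm_toSubalgebra x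
  have himg : ψ '' Set.range (S (n := n)) = Set.range CuntzAmbient.gen := by
    rw [← Set.range_comp]
    exact congrArg Set.range (funext fun i =>
      congrArg Subtype.val (StarAlgEquiv.apply_symm_apply (toSubalgebra n) _))
  have h := StarSubalgebra.topologicalClosure_map (StarAlgebra.adjoin ℂ (Set.range (S (n := n)))) ψ
    hiso.isClosedEmbedding.isClosedMap hiso.continuous
  rw [StarAlgHom.map_adjoin, himg] at h
  refine top_unique fun x _ => ?_
  have hx : ψ x ∈ cuntzSubalgebra n := (toSubalgebra n x).2
  rw [cuntzSubalgebra, h] at hx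
  obtain ⟨y, hy, hyx⟩ := hx
  rwa [← hiso.injective hyx]

/-- Two *-homomorphisms on `𝒪ₙ` that agree on `S₁, …, Sₙ` are equal. -/
theorem hom_ext {n : ℕ} {B : Type*} [CStarAlgebra B] {f g : CuntzAlgebra n →⋆ₐ[ℂ] B}
    (h : ∀ i, f (S i) = g (S i)) : f = g := by
  have hc : ∀ k : CuntzAlgebra n →⋆ₐ[ℂ] B, Continuous k := fun k =>
    AddMonoidHomClass.continuous_of_bound k 1 fun x => by
      rw [one_mul]; exact NonUnitalStarAlgHom.norm_apply_le k x
  have hle : (StarAlgebra.adjoin ℂ (Set.range (S (n := n)))).topologicalClosure ≤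
      StarAlgHom.equalizer f g :=
    StarSubalgebra.topologicalClosure_minimal
      (StarAlgebra.adjoin_le (by rintro _ ⟨i, rfl⟩; exact h i)) (isClosed_eq (hc f) (hc g))
  rw [adjoin_S_topologicalClosure] at hle
  exact StarAlgHom.ext fun x => hle (StarSubalgebra.mem_top (x := x))

/-- For a unitary `u` of `𝒪ₙ` and a Cuntz family `T`, the Cuntz family `u(T) Tᵢ`. -/
def twist {n : ℕ} (u : unitary (CuntzAlgebra n)) (T : CuntzFamily n) : CuntzFamily n where
  carrier := T.carrier
  gen i := eval T (u * S i)
  star_gen_mul_gen i := by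
    rw [← map_star, ← map_mul, star_mul, mul_assoc, ← mul_assoc (star (u : CuntzAlgebra n)),
      Unitary.coe_star_mul_self, one_mul, star_S_mul_S, map_one]
  sum_gen_mul_star := by
    simp only [← map_star, ← map_mul, ← map_sum]
    have : ∑ i : Fin n, (u * S i) * star ((u : CuntzAlgebra n) * S i) = 1 := by
      simp only [star_mul, ← mul_assoc]
      simp only [mul_assoc (u : CuntzAlgebra n), ← Finset.sum_mul, ← Finset.mul_sum]
      rw [sum_S_mul_star, one_mul]
      exact Unitary.mul_star_self_of_mem u.2
    rw [this, map_one]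

/-- The value of `x` at the twisted families, as a bounded function on Cuntz families. -/
def lamAmbient {n : ℕ} (u : unitary (CuntzAlgebra n)) : CuntzAlgebra n →⋆ₐ[ℂ] CuntzAmbient n where
  toFun x := ⟨fun T => (eval (twist u T) x : (twist u T).carrier), memℓp_infty ⟨‖x‖, by
    rintro _ ⟨T, rfl⟩; exact NonUnitalStarAlgHom.norm_apply_le (eval (twist u T)) x⟩⟩
  map_one' := lp.ext (funext fun T => map_one (eval (twist u T)))
  map_mul' x y := lp.ext (funext fun T => map_mul (eval (twist u T)) x y)
  map_zero' := lp.ext (funext fun T => map_zero (eval (twist u T)))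
  map_add' x y := lp.ext (funext fun T => map_add (eval (twist u T)) x y)
  commutes' c := lp.ext (funext fun T => AlgHomClass.commutes (eval (twist u T)) c)
  map_star' x := lp.ext (funext fun T => map_star (eval (twist u T)) x)

theorem lamAmbient_S {n : ℕ} (u : unitary (CuntzAlgebra n)) (i : Fin n) :
    lamAmbient u (S i) = toSubalgebra n (u * S i) :=
  lp.ext (funext fun T => eval_S (twist u T) i)

theorem lamAmbient_mem {n : ℕ} (u : unitary (CuntzAlgebra n)) (x : CuntzAlgebra n) :
    lamAmbient u x ∈ cuntzSubalgebra n := by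
  have hcl : IsClosed ((cuntzSubalgebra n).comap (lamAmbient u) : Set (CuntzAlgebra n)) :=
    (StarSubalgebra.isClosed_topologicalClosure _).preimage
      (AddMonoidHomClass.continuous_of_bound (lamAmbient u) 1 fun x => by
        rw [one_mul]; exact NonUnitalStarAlgHom.norm_apply_le (lamAmbient u) x)
  have h : (StarAlgebra.adjoin ℂ (Set.range (S (n := n)))).topologicalClosure ≤
      (cuntzSubalgebra n).comap (lamAmbient u) :=
    StarSubalgebra.topologicalClosure_minimal (StarAlgebra.adjoin_le (by
      rintro _ ⟨i, rfl⟩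
      change lamAmbient u (S i) ∈ cuntzSubalgebra n
      rw [lamAmbient_S]
      exact (toSubalgebra n (u * S i)).2)) hcl
  rw [adjoin_S_topologicalClosure] at h
  exact h (StarSubalgebra.mem_top)

/-- The endomorphism `λ_u` of `𝒪ₙ` attached to a unitary `u`. -/
def lam {n : ℕ} (u : unitary (CuntzAlgebra n)) : CuntzAlgebra n →⋆ₐ[ℂ] CuntzAlgebra n :=
  ((toSubalgebra n).symm : cuntzSubalgebra n →⋆ₐ[ℂ] CuntzAlgebra n).comp
    ((lamAmbient u).codRestrict (cuntzSubalgebra n) (lamAmbient_mem u))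

/-- `λ_u` is the unital *-endomorphism with `λ_u(Sᵢ) = u Sᵢ`. -/
theorem lam_S {n : ℕ} (u : unitary (CuntzAlgebra n)) (i : Fin n) : lam u (S i) = u * S i := by
  apply (toSubalgebra n).injective
  refine (StarAlgEquiv.apply_symm_apply (toSubalgebra n) _).trans (Subtype.ext ?_)
  exact lamAmbient_S u i

/-- The word `S_μ = S_{μ₁} ⋯ S_{μₖ}`, with `S_∅ = 1`. -/
def word {n : ℕ} (μ : List (Fin n)) : CuntzAlgebra n := (μ.map S).prod

/-- The range projection `P_μ = S_μ S_μ*`. -/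
def proj {n : ℕ} (μ : List (Fin n)) : CuntzAlgebra n := word μ * star (word μ)

/-- `ℱₙᵏ`, the span of the words `S_μ S_ν*` with `|μ| = |ν| = k`. -/
def coreLevel (n k : ℕ) : Submodule ℂ (CuntzAlgebra n) :=
  Submodule.span ℂ {x | ∃ μ ν : List (Fin n), μ.length = k ∧ ν.length = k ∧
    x = word μ * star (word ν)}

/-- The core UHF-subalgebra `ℱₙ`, the norm closure of `⋃ₖ ℱₙᵏ`. -/
def core (n : ℕ) : Set (CuntzAlgebra n) :=
  closure (⋃ k, (coreLevel n k : Set (CuntzAlgebra n)))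

/-- The diagonal `𝒟ₙ`, the C*-subalgebra generated by the projections `P_μ`. -/
def diagonal (n : ℕ) : StarSubalgebra ℂ (CuntzAlgebra n) :=
  (StarAlgebra.adjoin ℂ (Set.range (proj (n := n)))).topologicalClosure

/-- `𝒮ₙ`, the unitaries that are finite sums of words `S_α S_β*`. -/
def wordUnitaries (n : ℕ) : Set (unitary (CuntzAlgebra n)) :=
  {u | ∃ J : Finset (List (Fin n) × List (Fin n)),
    (u : CuntzAlgebra n) = ∑ p ∈ J, word p.1 * star (word p.2)}

/-- `Aut(𝒪ₙ) λ(ℱₙ)`, the endomorphisms `ψ ∘ λ_w` with `ψ` an automorphism of `𝒪ₙ` and `w` a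
unitary in `ℱₙ`. -/
def autMulLamCore (n : ℕ) : Set (CuntzAlgebra n →⋆ₐ[ℂ] CuntzAlgebra n) :=
  {ρ | ∃ (ψ : CuntzAlgebra n ≃⋆ₐ[ℂ] CuntzAlgebra n) (w : unitary (CuntzAlgebra n)),
    (w : CuntzAlgebra n) ∈ core n ∧
      ρ = (ψ : CuntzAlgebra n →⋆ₐ[ℂ] CuntzAlgebra n).comp (lam w)}

/-- The space `ρ(𝒟ₙ) Q = {ρ(d) Q : d ∈ 𝒟ₙ}`. -/
def diagonalImageMul {n : ℕ} (ρ : CuntzAlgebra n →⋆ₐ[ℂ] CuntzAlgebra n) (Q : CuntzAlgebra n) :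
    Submodule ℂ (CuntzAlgebra n) :=
  Submodule.map (LinearMap.mulRight ℂ Q ∘ₗ (ρ : CuntzAlgebra n →ₗ[ℂ] CuntzAlgebra n))
    (Subalgebra.toSubmodule (diagonal n).toSubalgebra)

theorem mem_diagonalImageMul {n : ℕ} {ρ : CuntzAlgebra n →⋆ₐ[ℂ] CuntzAlgebra n}
    {Q x : CuntzAlgebra n} :
    x ∈ diagonalImageMul ρ Q ↔ ∃ d ∈ diagonal n, ρ d * Q = x := Iff.rfl

end CuntzAlgebra

end

/-! ### Words in the generators and the algebra structure of the core -/

noncomputable section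

open Filter Topology

namespace CuntzAlgebra

variable {n : ℕ}

/-! The infinite-dimensionality statement rests on a faithful state. On the core, the averages of
S_μ* x S_μ over words of length k tend to τ(x)1, with τ the trace; the state in the background is τ
composed with the conditional expectation onto the core. Neither is constructed: only the space
`avgNull` of elements whose averages tend to 0 is used, and "x has trace c" is read as x - c·1 ∈
`avgNull`.

For a unitary w in the core, λ_w(P_{iμ}) is conjugate by w to S_i λ_w(P_μ) S_i*, so the trace
property gives λ_w(P_μ) trace n^{-|μ|} (`lam_proj_sub_mem_avgNull`). If λ_w(𝒟ₙ)Q had dimension d, at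
most d of the orthogonal projections λ_w(P_μ), |μ| = k, could fail to annihilate Q. Then Q lies
below their sum (`exists_le_sum_proj`), of trace at most d n^{-k}. Letting k grow puts Q in
`avgNull`, and faithfulness (`eq_zero_of_nonneg_of_mem_avgNull`) forces Q = 0.

Faithfulness is the analytic core. The isometries φ^m(S_i), with φ the canonical shift, commute with
level m of the core, so averaging over them fixes that level, yet it still sends positive null
elements to 0. Hence a positive null element cannot be close to a nonzero element of a level,
relative to the norm of the latter. Averaging over roots of unity under the gauge action moves
approximants into a level, while a positive element keeps a definite fraction of its norm.

For the opposite behaviour, let u exchange the ranges of S_b and S_a S_b. Then λ_u(S_a) fixes S_b,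
each λ_u(P_μ)P_b is P_b or 0, and λ_u(𝒟ₙ)P_b is a line. Automorphisms preserve these dimensions, so
λ_u is not of the form ψ ∘ λ_w with w in the core. -/

theorem star_S_mul_S_of_ne {i j : Fin n} (h : i ≠ j) : star (S i) * S j = 0 := by
  let _ : PartialOrder (CuntzAlgebra n) := CStarAlgebra.spectralOrder _
  have _ : StarOrderedRing (CuntzAlgebra n) := CStarAlgebra.spectralOrderedRing _
  have h1 : ∑ k : Fin n, star (S j) * (S k * star (S k)) * S j = 1 := by
    rw [← Finset.sum_mul, ← Finset.mul_sum, sum_S_mul_star, mul_one, star_S_mul_S]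
  have h2 : ∀ k : Fin n, star (S j) * (S k * star (S k)) * S j =
      star (star (S k) * S j) * (star (S k) * S j) := fun k => by
    simp only [star_mul, star_star, mul_assoc]
  -- The term k = j is already 1, so the remaining terms are positive elements with sum 0, and each
  -- vanishes.
  rw [← Finset.add_sum_erase _ _ (Finset.mem_univ j), h2 j, star_S_mul_S, star_one, one_mul,
    add_eq_left, Finset.sum_eq_zero_iff_of_nonneg fun k _ => h2 k ▸ star_mul_self_nonneg _] at h1
  have h3 := h1 i (Finset.mem_erase.2 ⟨h, Finset.mem_univ _⟩)
  rw [h2] at h3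
  exact CStarRing.star_mul_self_eq_zero_iff _ |>.1 h3

theorem star_S_mul_S_eq_ite (i j : Fin n) :
    star (S i) * S j = if i = j then (1 : CuntzAlgebra n) else 0 := by
  split_ifs with h
  · rw [h, star_S_mul_S]
  · exact star_S_mul_S_of_ne h

theorem norm_le_one_of_star_mul_self_eq_one {v : CuntzAlgebra n} (h : star v * v = 1) :
    ‖v‖ ≤ 1 := by
  have h1 := CStarRing.norm_star_mul_self (x := v)
  rw [h] at h1
  rcases subsingleton_or_nontrivial (CuntzAlgebra n) with h0 | h0
  · rw [Subsingleton.elim v 0, norm_zero]; exact zero_le_one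
  · rw [norm_one] at h1
    nlinarith [norm_nonneg v]

theorem norm_S_le (i : Fin n) : ‖(S i : CuntzAlgebra n)‖ ≤ 1 :=
  norm_le_one_of_star_mul_self_eq_one (star_S_mul_S i)

@[simp] theorem word_nil : word ([] : List (Fin n)) = 1 := rfl

theorem word_cons (i : Fin n) (μ : List (Fin n)) : word (i :: μ) = S i * word μ := by
  simp [word]

theorem word_append (μ ν : List (Fin n)) : word (μ ++ ν) = word μ * word ν := by
  simp [word]

theorem star_word_mul_word_self (μ : List (Fin n)) : star (word μ) * word μ = 1 := by
  induction μ with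
  | nil => simp
  | cons i μ ih =>
    rw [word_cons, star_mul, mul_assoc, ← mul_assoc (star (S i)), star_S_mul_S, one_mul, ih]

theorem star_word_mul_word {μ ν : List (Fin n)} (h : μ.length = ν.length) :
    star (word μ) * word ν = if μ = ν then (1 : CuntzAlgebra n) else 0 := by
  induction μ generalizing ν with
  | nil => simp [List.length_eq_zero_iff.1 h.symm]
  | cons i μ ih =>
    obtain _ | ⟨j, ν⟩ := ν
    · simp at h
    · rw [word_cons, word_cons, star_mul, mul_assoc, ← mul_assoc (star (S i)),
        star_S_mul_S_eq_ite]
      split_ifs with h1 h2 h2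
      · rw [one_mul, ih (by simpa using h)]; simp_all
      · rw [one_mul, ih (by simpa using h)]; simp_all
      · simp_all
      · simp

/-- Insert ∑ S_i S_i* = 1 between S_μ and S_ν*. -/
theorem coreLevel_le_succ (k : ℕ) : coreLevel n k ≤ coreLevel n (k + 1) := by
  refine Submodule.span_le.2 ?_
  rintro _ ⟨μ, ν, hμ, hν, rfl⟩
  have : word μ * star (word ν) =
      ∑ i : Fin n, word (μ ++ [i]) * star (word (ν ++ [i])) := by
    simp only [word_append, star_mul, word_cons, word_nil, mul_one]
    simp only [mul_assoc, ← Finset.mul_sum]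
    simp only [← mul_assoc (S _) (star (S _)), ← Finset.sum_mul, sum_S_mul_star, one_mul]
  rw [this]
  exact Submodule.sum_mem _ fun i _ => Submodule.subset_span ⟨_, _, by simp [hμ], by simp [hν], rfl⟩

theorem coreLevel_mono : Monotone (coreLevel n) := monotone_nat_of_le_succ coreLevel_le_succ

theorem mul_mem_coreLevel {k : ℕ} {x y : CuntzAlgebra n} (hx : x ∈ coreLevel n k)
    (hy : y ∈ coreLevel n k) : x * y ∈ coreLevel n k := by
  induction hx using Submodule.span_induction with
  | zero => simp
  | add a b _ _ ha hb => rw [add_mul]; exact add_mem ha hb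
  | smul c a _ ha => rw [smul_mul_assoc]; exact Submodule.smul_mem _ _ ha
  | mem a ha =>
    obtain ⟨α, β, hα, hβ, rfl⟩ := ha
    induction hy using Submodule.span_induction with
    | zero => simp
    | add a b _ _ ha hb => rw [mul_add]; exact add_mem ha hb
    | smul c a _ ha => rw [mul_smul_comm]; exact Submodule.smul_mem _ _ ha
    | mem b hb =>
      obtain ⟨γ, δ, hγ, hδ, rfl⟩ := hb
      rw [mul_assoc, ← mul_assoc (star _), star_word_mul_word (hβ.trans hγ.symm)]
      split_ifs
      · rw [one_mul]; exact Submodule.subset_span ⟨_, _, hα, hδ, rfl⟩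
      · simp

theorem star_mem_coreLevel {k : ℕ} {x : CuntzAlgebra n} (hx : x ∈ coreLevel n k) :
    star x ∈ coreLevel n k := by
  induction hx using Submodule.span_induction with
  | zero => simp
  | add a b _ _ ha hb => rw [star_add]; exact add_mem ha hb
  | smul c a _ ha => rw [star_smul]; exact Submodule.smul_mem _ _ ha
  | mem a ha =>
    obtain ⟨α, β, hα, hβ, rfl⟩ := ha
    rw [star_mul, star_star]
    exact Submodule.subset_span ⟨_, _, hβ, hα, rfl⟩

theorem S_mul_mul_star_mem_coreLevel {k : ℕ} (i : Fin n) {x : CuntzAlgebra n}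
    (hx : x ∈ coreLevel n k) : S i * x * star (S i) ∈ coreLevel n (k + 1) := by
  induction hx using Submodule.span_induction with
  | zero => simp
  | add a b _ _ ha hb => rw [mul_add, add_mul]; exact add_mem ha hb
  | smul c a _ ha => rw [mul_smul_comm, smul_mul_assoc]; exact Submodule.smul_mem _ _ ha
  | mem a ha =>
    obtain ⟨α, β, hα, hβ, rfl⟩ := ha
    refine Submodule.subset_span ⟨i :: α, i :: β, by simp [hα], by simp [hβ], ?_⟩
    simp only [word_cons, star_mul, mul_assoc]

theorem exists_mem_coreLevel_pair {x y : CuntzAlgebra n}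
    (hx : x ∈ ⋃ k, (coreLevel n k : Set (CuntzAlgebra n)))
    (hy : y ∈ ⋃ k, (coreLevel n k : Set (CuntzAlgebra n))) :
    ∃ k, x ∈ coreLevel n k ∧ y ∈ coreLevel n k := by
  obtain ⟨k, hk⟩ := Set.mem_iUnion.1 hx
  obtain ⟨l, hl⟩ := Set.mem_iUnion.1 hy
  exact ⟨max k l, coreLevel_mono (le_max_left _ _) hk, coreLevel_mono (le_max_right _ _) hl⟩

theorem mul_mem_core {x y : CuntzAlgebra n} (hx : x ∈ core n) (hy : y ∈ core n) :
    x * y ∈ core n :=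
  map_mem_closure₂ continuous_mul hx hy fun a ha b hb => by
    obtain ⟨k, h1, h2⟩ := exists_mem_coreLevel_pair ha hb
    exact Set.mem_iUnion.2 ⟨k, mul_mem_coreLevel h1 h2⟩

theorem star_mem_core {x : CuntzAlgebra n} (hx : x ∈ core n) : star x ∈ core n :=
  map_mem_closure continuous_star hx fun a ha => by
    obtain ⟨k, h⟩ := Set.mem_iUnion.1 ha
    exact Set.mem_iUnion.2 ⟨k, star_mem_coreLevel h⟩

theorem S_mul_mul_star_mem_core (i : Fin n) {x : CuntzAlgebra n} (hx : x ∈ core n) :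
    S i * x * star (S i) ∈ core n :=
  map_mem_closure (f := fun x => S i * x * star (S i)) (by fun_prop) hx fun a ha => by
    obtain ⟨k, h⟩ := Set.mem_iUnion.1 ha
    exact Set.mem_iUnion.2 ⟨k + 1, S_mul_mul_star_mem_coreLevel i h⟩

theorem one_mem_core : (1 : CuntzAlgebra n) ∈ core n :=
  subset_closure (Set.mem_iUnion.2 ⟨0, Submodule.subset_span ⟨[], [], rfl, rfl, by simp⟩⟩)

/-! ### Iterated averages and the trace on the core -/

/-- The average `x ↦ n⁻¹ ∑ᵢ Vᵢ* x Vᵢ` over a family `V` of elements of `𝒪ₙ`. -/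
def conjAvg (V : Fin n → CuntzAlgebra n) : CuntzAlgebra n →ₗ[ℂ] CuntzAlgebra n :=
  (n : ℂ)⁻¹ • ∑ i, LinearMap.mulLeftRight ℂ (star (V i), V i)

theorem conjAvg_apply (V : Fin n → CuntzAlgebra n) (x : CuntzAlgebra n) :
    conjAvg V x = (n : ℂ)⁻¹ • ∑ i, star (V i) * x * V i := by
  simp [conjAvg, LinearMap.sum_apply]

theorem norm_conjAvg_le {V : Fin n → CuntzAlgebra n} (hV : ∀ i, ‖V i‖ ≤ 1)
    (x : CuntzAlgebra n) : ‖conjAvg V x‖ ≤ ‖x‖ := by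
  rw [conjAvg_apply, norm_smul, norm_inv, Complex.norm_natCast]
  have h : ‖∑ i, star (V i) * x * V i‖ ≤ n * ‖x‖ := by
    refine (norm_sum_le_of_le (f := fun i => star (V i) * x * V i) Finset.univ
      (n := fun _ => ‖x‖) fun i _ => ?_).trans (by simp)
    calc ‖star (V i) * x * V i‖ ≤ ‖star (V i)‖ * ‖x‖ * ‖V i‖ :=
          (norm_mul_le _ _).trans (by gcongr; exact norm_mul_le _ _)
      _ ≤ 1 * ‖x‖ * 1 := by
          rw [norm_star]; gcongr <;> exact hV i
      _ = ‖x‖ := by ring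
  rcases Nat.eq_zero_or_pos n with h0 | h0
  · subst h0; simp
  · rw [inv_mul_le_iff₀ (by positivity)]; exact h

theorem norm_conjAvg_pow_le {V : Fin n → CuntzAlgebra n} (hV : ∀ i, ‖V i‖ ≤ 1) (k : ℕ)
    (x : CuntzAlgebra n) : ‖(conjAvg V ^ k) x‖ ≤ ‖x‖ := by
  induction k with
  | zero => simp
  | succ k ih =>
    rw [pow_succ', Module.End.mul_apply]
    exact (norm_conjAvg_le hV _).trans ih

/-- The elements of `𝒪ₙ` whose iterated averages `n⁻ᵏ ∑ S_μ* x S_μ` over the words of length `k`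
tend to zero. -/
def avgNull (n : ℕ) : Submodule ℂ (CuntzAlgebra n) where
  carrier := {x | Tendsto (fun k => (conjAvg S ^ k) x) atTop (𝓝 0)}
  add_mem' hx hy := by simpa using hx.add hy
  zero_mem' := by simp
  smul_mem' c x hx := by simpa using hx.const_smul c

theorem mem_avgNull {x : CuntzAlgebra n} :
    x ∈ avgNull n ↔ Tendsto (fun k => (conjAvg S ^ k) x) atTop (𝓝 0) := Iff.rfl

theorem mem_avgNull_of_pow_eq_zero {x : CuntzAlgebra n} {k : ℕ} (h : (conjAvg S ^ k) x = 0) :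
    x ∈ avgNull n :=
  tendsto_const_nhds.congr' <| (eventually_ge_atTop k).mono fun l hl => by
    obtain ⟨m, rfl⟩ := Nat.exists_eq_add_of_le' hl
    simp only [pow_add, Module.End.mul_apply, h, map_zero]

theorem mem_avgNull_of_conjAvg {x : CuntzAlgebra n} (h : conjAvg S x ∈ avgNull n) :
    x ∈ avgNull n := by
  rw [mem_avgNull] at h ⊢
  rw [← tendsto_add_atTop_iff_nat 1]
  simpa only [pow_succ, Module.End.mul_apply] using h

/-- The iterated averages are contractions, so a small perturbation of a null element stays small
uniformly in k. -/
theorem isClosed_avgNull : IsClosed (avgNull n : Set (CuntzAlgebra n)) := by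
  refine isClosed_of_closure_subset fun x hx => ?_
  rw [SetLike.mem_coe, mem_avgNull, Metric.tendsto_atTop]
  intro ε hε
  obtain ⟨y, hy, hxy⟩ := Metric.mem_closure_iff.1 hx (ε / 2) (half_pos hε)
  obtain ⟨N, hN⟩ := Metric.tendsto_atTop.1 (mem_avgNull.1 hy) (ε / 2) (half_pos hε)
  refine ⟨N, fun k hk => ?_⟩
  have h1 := hN k hk
  rw [dist_zero_right] at h1 ⊢
  rw [dist_eq_norm] at hxy
  calc ‖(conjAvg S ^ k) x‖ = ‖(conjAvg S ^ k) (x - y) + (conjAvg S ^ k) y‖ := by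
        rw [← map_add, sub_add_cancel]
    _ ≤ ‖x - y‖ + ‖(conjAvg S ^ k) y‖ :=
        (norm_add_le _ _).trans (by gcongr; exact norm_conjAvg_pow_le norm_S_le k _)
    _ < ε := by linarith

theorem conjAvg_S_mul_mul_star (i j : Fin n) (x : CuntzAlgebra n) :
    conjAvg S (S i * x * star (S j)) = if i = j then (n : ℂ)⁻¹ • x else 0 := by
  have h : ∀ k : Fin n, star (S k) * (S i * x * star (S j)) * S k =
      if k = i then (if i = j then x else 0) else 0 := fun k => by
    calc star (S k) * (S i * x * star (S j)) * S k
        = (star (S k) * S i) * x * (star (S j) * S k) := by simp only [mul_assoc]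
      _ = _ := by
        rw [star_S_mul_S_eq_ite, star_S_mul_S_eq_ite]
        split_ifs <;> simp_all
  rw [conjAvg_apply, Finset.sum_congr rfl fun k _ => h k]
  simp

theorem conjAvg_pow_word_mul_star_word {k : ℕ} {α β : List (Fin n)} (hα : α.length = k)
    (hβ : β.length = k) : (conjAvg S ^ k) (word α * star (word β)) =
      if α = β then ((n : ℂ)⁻¹ ^ k) • (1 : CuntzAlgebra n) else 0 := by
  induction k generalizing α β with
  | zero => simp [List.length_eq_zero_iff.1 hα, List.length_eq_zero_iff.1 hβ]
  | succ k ih =>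
    obtain _ | ⟨i, α⟩ := α
    · simp at hα
    obtain _ | ⟨j, β⟩ := β
    · simp at hβ
    have : word (i :: α) * star (word (j :: β)) =
        S i * (word α * star (word β)) * star (S j) := by
      simp only [word_cons, star_mul, mul_assoc]
    rw [this, pow_succ, Module.End.mul_apply, conjAvg_S_mul_mul_star]
    split_ifs with h1 h2 h2
    · rw [map_smul, ih (by simpa using hα) (by simpa using hβ), if_pos (by simp_all), smul_smul,
        pow_succ']
    · rw [map_smul, ih (by simpa using hα) (by simpa using hβ), if_neg (by simp_all), smul_zero]
    · simp_all
    · simp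

/-- The limit of the iterated averages is a trace on each level of the core. -/
theorem conjAvg_pow_commutator {k : ℕ} {x y : CuntzAlgebra n} (hx : x ∈ coreLevel n k)
    (hy : y ∈ coreLevel n k) : (conjAvg S ^ k) (x * y - y * x) = 0 := by
  rw [map_sub, sub_eq_zero]
  induction hx using Submodule.span_induction with
  | zero => simp
  | add a b _ _ ha hb => rw [add_mul, mul_add, map_add, map_add, ha, hb]
  | smul c a _ ha => rw [smul_mul_assoc, mul_smul_comm, map_smul, map_smul, ha]
  | mem a ha =>
    obtain ⟨α, β, hα, hβ, rfl⟩ := ha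
    induction hy using Submodule.span_induction with
    | zero => simp
    | add a b _ _ ha hb => rw [add_mul, mul_add, map_add, map_add, ha, hb]
    | smul c a _ ha => rw [smul_mul_assoc, mul_smul_comm, map_smul, map_smul, ha]
    | mem b hb =>
      obtain ⟨γ, δ, hγ, hδ, rfl⟩ := hb
      have h : ∀ {α β γ δ : List (Fin n)}, α.length = k → β.length = k → γ.length = k →
          δ.length = k →
          (conjAvg S ^ k) (word α * star (word β) * (word γ * star (word δ))) =
            if β = γ ∧ α = δ then ((n : ℂ)⁻¹ ^ k) • (1 : CuntzAlgebra n) else 0 := by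
        intro α β γ δ hα hβ hγ hδ
        rw [mul_assoc, ← mul_assoc (star _), star_word_mul_word (hβ.trans hγ.symm)]
        by_cases h1 : β = γ
        · rw [if_pos h1, one_mul, conjAvg_pow_word_mul_star_word hα hδ]
          simp [h1]
        · simp [h1]
      rw [h hα hβ hγ hδ, h hγ hδ hα hβ]
      simp only [eq_comm, and_comm]

/-- On a level the commutator is killed after finitely many averages; density of the levels and
closedness of `avgNull` do the rest. -/
theorem commutator_mem_avgNull {x y : CuntzAlgebra n} (hx : x ∈ core n) (hy : y ∈ core n) :
    x * y - y * x ∈ avgNull n := by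
  have := map_mem_closure₂ (f := fun x y : CuntzAlgebra n => x * y - y * x) (by fun_prop) hx hy
    (u := (avgNull n : Set (CuntzAlgebra n))) fun a ha b hb => by
      obtain ⟨k, h1, h2⟩ := exists_mem_coreLevel_pair ha hb
      exact mem_avgNull_of_pow_eq_zero (conjAvg_pow_commutator h1 h2)
  rwa [isClosed_avgNull.closure_eq] at this

theorem lam_proj_cons (w : unitary (CuntzAlgebra n)) (i : Fin n) (μ : List (Fin n)) :
    lam w (proj (i :: μ)) = w * (S i * lam w (proj μ) * star (S i)) * star (w : CuntzAlgebra n) := by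
  simp only [proj, word_cons, map_mul, map_star, star_mul, lam_S, mul_assoc]

theorem lam_proj_mem_core {w : unitary (CuntzAlgebra n)} (hw : (w : CuntzAlgebra n) ∈ core n)
    (μ : List (Fin n)) : lam w (proj μ) ∈ core n := by
  induction μ with
  | nil => simpa [proj] using one_mem_core
  | cons i μ ih =>
    rw [lam_proj_cons]
    exact mul_mem_core (mul_mem_core hw (S_mul_mul_star_mem_core i ih)) (star_mem_core hw)

/-- The trace of `λ_w(P_μ)` is `n^{-|μ|}` for a unitary `w` in the core. -/
theorem lam_proj_sub_mem_avgNull {w : unitary (CuntzAlgebra n)}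
    (hw : (w : CuntzAlgebra n) ∈ core n) (μ : List (Fin n)) :
    lam w (proj μ) - ((n : ℂ)⁻¹ ^ μ.length) • (1 : CuntzAlgebra n) ∈ avgNull n := by
  induction μ with
  | nil => simp [proj]
  | cons i μ ih =>
    set y := lam w (proj μ)
    have hy : S i * y * star (S i) ∈ core n := S_mul_mul_star_mem_core i (lam_proj_mem_core hw μ)
    -- The commutator of w S_i y S_i* with w* is λ_w(P_{iμ}) - S_i y S_i*, because w*w = 1.
    have h1 := commutator_mem_avgNull (mul_mem_core hw hy) (star_mem_core hw)
    rw [← lam_proj_cons, ← mul_assoc (star (w : CuntzAlgebra n)), Unitary.coe_star_mul_self,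
      one_mul] at h1
    have hn : (n : ℂ) ≠ 0 := Nat.cast_ne_zero.2 i.pos.ne'
    -- One average turns S_i y S_i* into n⁻¹ y and fixes 1, which leaves n⁻¹ times the induction
    -- hypothesis.
    have h2 : S i * y * star (S i) -
        ((n : ℂ)⁻¹ ^ (i :: μ).length) • (1 : CuntzAlgebra n) ∈ avgNull n := by
      refine mem_avgNull_of_conjAvg ?_
      have h3 : conjAvg S (1 : CuntzAlgebra n) = 1 := by
        simp [conjAvg_apply, star_S_mul_S, ← Nat.cast_smul_eq_nsmul ℂ, smul_smul, hn]
      rw [map_sub, map_smul, h3, conjAvg_S_mul_mul_star, if_pos rfl, List.length_cons, pow_succ',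
        mul_smul, ← smul_sub]
      exact Submodule.smul_mem _ _ ih
    simpa using add_mem h1 h2

end CuntzAlgebra

end

/-! ### Averages over shifted generators -/

noncomputable section

open Filter Topology

namespace CuntzAlgebra

variable {n : ℕ}

/-- The images `φᵐ(Sᵢ)` of the generators under the powers of the canonical shift
`φ(x) = ∑ⱼ Sⱼ x Sⱼ*`. -/
def shiftS : ℕ → Fin n → CuntzAlgebra n
  | 0, i => S i
  | m + 1, i => ∑ j, S j * shiftS m i * star (S j)

theorem shiftS_succ (m : ℕ) (i : Fin n) :
    shiftS (m + 1) i = ∑ j, S j * shiftS m i * star (S j) := rfl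

theorem shiftS_succ_mul_S (m : ℕ) (i j : Fin n) :
    shiftS (m + 1) i * S j = S j * shiftS m i := by
  simp [shiftS_succ, Finset.sum_mul, mul_assoc, star_S_mul_S_eq_ite]

theorem star_S_mul_shiftS_succ (m : ℕ) (i j : Fin n) :
    star (S j) * shiftS (m + 1) i = shiftS m i * star (S j) := by
  simp only [shiftS_succ, Finset.mul_sum, ← mul_assoc, star_S_mul_S_eq_ite]
  simp

theorem star_shiftS_mul_shiftS (m : ℕ) (i : Fin n) :
    star (shiftS m i) * shiftS m i = 1 := by
  induction m with
  | zero => exact star_S_mul_S i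
  | succ m ih =>
    have h : ∀ j : Fin n, star (S j * shiftS m i * star (S j)) * shiftS (m + 1) i =
        S j * star (S j) := fun j => by
      calc star (S j * shiftS m i * star (S j)) * shiftS (m + 1) i
          = S j * star (shiftS m i) * (star (S j) * shiftS (m + 1) i) := by
            simp only [star_mul, star_star, mul_assoc]
        _ = S j * (star (shiftS m i) * shiftS m i) * star (S j) := by
            rw [star_S_mul_shiftS_succ]; simp only [mul_assoc]
        _ = S j * star (S j) := by rw [ih, mul_one]
    nth_rewrite 1 [shiftS_succ]
    rw [star_sum, Finset.sum_mul, Finset.sum_congr rfl fun j _ => h j, sum_S_mul_star]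

theorem norm_shiftS_le (m : ℕ) (i : Fin n) : ‖(shiftS m i : CuntzAlgebra n)‖ ≤ 1 :=
  norm_le_one_of_star_mul_self_eq_one (star_shiftS_mul_shiftS m i)

theorem star_word_mul_shiftS {m : ℕ} (i : Fin n) {μ : List (Fin n)} (hμ : μ.length = m) :
    star (word μ) * shiftS m i = S i * star (word μ) := by
  induction m generalizing μ with
  | zero => simp [List.length_eq_zero_iff.1 hμ, shiftS]
  | succ m ih =>
    obtain _ | ⟨j, μ⟩ := μ
    · simp at hμ
    · rw [word_cons, star_mul, mul_assoc, star_S_mul_shiftS_succ, ← mul_assoc,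
        ih (by simpa using hμ), mul_assoc]

/-- The relation φ(y) S_j = S_j y turns a corner of the average at shift m + 1 into the average at
shift m of that corner, which permits induction on m. -/
theorem star_S_mul_conjAvg_shiftS_mul_S (m : ℕ) (i j : Fin n) (x : CuntzAlgebra n) :
    star (S i) * conjAvg (shiftS (m + 1)) x * S j =
      conjAvg (shiftS m) (star (S i) * x * S j) := by
  simp only [conjAvg_apply, mul_smul_comm, smul_mul_assoc, Finset.mul_sum, Finset.sum_mul]
  congr 1
  refine Finset.sum_congr rfl fun k _ => ?_
  calc star (S i) * (star (shiftS (m + 1) k) * x * shiftS (m + 1) k) * S j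
      = star (shiftS (m + 1) k * S i) * x * (shiftS (m + 1) k * S j) := by
        simp only [star_mul, mul_assoc]
    _ = _ := by
        rw [shiftS_succ_mul_S, shiftS_succ_mul_S]; simp only [star_mul, mul_assoc]

theorem star_S_mul_conjAvg_shiftS_pow_mul_S (m k : ℕ) (i j : Fin n) (x : CuntzAlgebra n) :
    star (S i) * (conjAvg (shiftS (m + 1)) ^ k) x * S j =
      (conjAvg (shiftS m) ^ k) (star (S i) * x * S j) := by
  induction k generalizing x with
  | zero => simp
  | succ k ih =>
    rw [pow_succ, pow_succ, Module.End.mul_apply, Module.End.mul_apply, ih,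
      star_S_mul_conjAvg_shiftS_mul_S]

/-- φ^m(S_i) commutes with S_α S_β* when |α| = |β| = m, and it is an isometry, so each conjugate
returns the element itself. -/
theorem conjAvg_shiftS_of_mem_coreLevel (hn : n ≠ 0) {m : ℕ} {x : CuntzAlgebra n}
    (hx : x ∈ coreLevel n m) : conjAvg (shiftS m) x = x := by
  induction hx using Submodule.span_induction with
  | zero => simp
  | add a b _ _ ha hb => rw [map_add, ha, hb]
  | smul c a _ ha => rw [map_smul, ha]
  | mem a ha =>
    obtain ⟨α, β, hα, hβ, rfl⟩ := ha
    have h : ∀ i : Fin n, star (shiftS m i) * (word α * star (word β)) * shiftS m i =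
        word α * star (word β) := fun i => by
      have h1 : star (shiftS m i) * word α = word α * star (S i) := by
        rw [← star_star (word α), ← star_mul, star_word_mul_shiftS i hα, star_mul]
      calc star (shiftS m i) * (word α * star (word β)) * shiftS m i
          = star (shiftS m i) * word α * (star (word β) * shiftS m i) := by
            simp only [mul_assoc]
        _ = word α * (star (S i) * S i) * star (word β) := by
            rw [h1, star_word_mul_shiftS i hβ]; simp only [mul_assoc]
        _ = word α * star (word β) := by rw [star_S_mul_S, mul_one]
    have hn' : (n : ℂ) ≠ 0 := Nat.cast_ne_zero.2 hn
    simp [conjAvg_apply, h, ← Nat.cast_smul_eq_nsmul ℂ, smul_smul, hn']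

-- Positivity and null elements

attribute [local instance] CStarAlgebra.spectralOrder CStarAlgebra.spectralOrderedRing

theorem conjAvg_nonneg (V : Fin n → CuntzAlgebra n) {x : CuntzAlgebra n} (hx : 0 ≤ x) :
    0 ≤ conjAvg V x := by
  have h : conjAvg V x = (n : ℝ)⁻¹ • ∑ i, star (V i) * x * V i := by
    rw [conjAvg_apply, ← Complex.coe_smul]; simp
  rw [h]
  exact smul_nonneg (by positivity) (Finset.sum_nonneg fun i _ => star_left_conjugate_nonneg hx _)

theorem conjAvg_pow_nonneg (V : Fin n → CuntzAlgebra n) (k : ℕ) {x : CuntzAlgebra n}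
    (hx : 0 ≤ x) : 0 ≤ (conjAvg V ^ k) x := by
  induction k with
  | zero => simpa
  | succ k ih => rw [pow_succ', Module.End.mul_apply]; exact conjAvg_nonneg V ih

theorem conjAvg_pow_mono (V : Fin n → CuntzAlgebra n) (k : ℕ) {x y : CuntzAlgebra n}
    (hxy : x ≤ y) : (conjAvg V ^ k) x ≤ (conjAvg V ^ k) y := by
  rw [← sub_nonneg, ← map_sub]
  exact conjAvg_pow_nonneg V k (sub_nonneg.2 hxy)

theorem mem_avgNull_of_le {x y : CuntzAlgebra n} (hx : 0 ≤ x) (hxy : x ≤ y)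
    (hy : y ∈ avgNull n) : x ∈ avgNull n :=
  squeeze_zero_norm (fun k => CStarAlgebra.norm_le_norm_of_nonneg_of_le
    (conjAvg_pow_nonneg S k hx) (conjAvg_pow_mono S k hxy)) (by simpa using (mem_avgNull.1 hy).norm)

/-- For positive x the corner S_i* x S_i is one summand of n times the average, hence is dominated
by a null element. -/
theorem star_S_mul_mul_S_mem_avgNull (i : Fin n) {x : CuntzAlgebra n} (hx : 0 ≤ x)
    (h : x ∈ avgNull n) : star (S i) * x * S i ∈ avgNull n := by
  have hn : (n : ℂ) ≠ 0 := Nat.cast_ne_zero.2 i.pos.ne'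
  refine mem_avgNull_of_le (y := (n : ℂ) • conjAvg S x) (star_left_conjugate_nonneg hx _) ?_
    (Submodule.smul_mem _ _ ?_)
  · rw [conjAvg_apply, smul_smul, mul_inv_cancel₀ hn, one_smul]
    exact Finset.single_le_sum (f := fun i => star (S i) * x * S i)
      (fun j _ => star_left_conjugate_nonneg hx _) (Finset.mem_univ i)
  · have := (tendsto_add_atTop_iff_nat 1).2 (mem_avgNull.1 h)
    rw [mem_avgNull]
    simpa only [pow_succ, Module.End.mul_apply] using this

/-- A sequence of positive elements tends to zero if its diagonal corners do. -/
theorem tendsto_zero_of_corners {y : ℕ → CuntzAlgebra n} (hy : ∀ k, 0 ≤ y k)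
    (h : ∀ i : Fin n, Tendsto (fun k => star (S i) * y k * S i) atTop (𝓝 0)) :
    Tendsto y atTop (𝓝 0) := by
  -- Write y = a*a. Then ‖a S_i‖² is the norm of a diagonal corner, and a = ∑ a S_i S_i* shows that
  -- diagonal corners alone control y.
  choose a ha using fun k => CStarAlgebra.nonneg_iff_eq_star_mul_self.1 (hy k)
  have h1 : ∀ i : Fin n, Tendsto (fun k => ‖a k * S i‖) atTop (𝓝 0) := fun i => by
    have h2 : ∀ k, ‖a k * S i‖ = √‖star (S i) * y k * S i‖ := fun k => by
      rw [eq_comm, Real.sqrt_eq_iff_mul_self_eq (norm_nonneg _) (norm_nonneg _),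
        ← CStarRing.norm_star_mul_self, ha, star_mul]
      simp only [mul_assoc]
    simp only [h2]
    simpa using (h i).norm.sqrt
  have h3 : Tendsto (fun k => ∑ i : Fin n, ‖a k * S i‖) atTop (𝓝 0) := by
    simpa using tendsto_finsetSum Finset.univ fun i _ => h1 i
  have h4 : ∀ k, ‖a k‖ ≤ ∑ i : Fin n, ‖a k * S i‖ := fun k => by
    calc ‖a k‖ = ‖∑ i : Fin n, a k * S i * star (S i)‖ := by
          simp only [mul_assoc, ← Finset.mul_sum, sum_S_mul_star, mul_one]
      _ ≤ _ := norm_sum_le_of_le _ fun i _ => by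
          refine (norm_mul_le _ _).trans (mul_le_of_le_one_right (norm_nonneg _) ?_)
          rw [norm_star]; exact norm_S_le i
  have h5 : Tendsto a atTop (𝓝 0) := squeeze_zero_norm h4 h3
  rw [funext ha]
  simpa using (h5.star).mul h5

theorem tendsto_conjAvg_shiftS_pow (m : ℕ) {x : CuntzAlgebra n} (hx : 0 ≤ x)
    (h : x ∈ avgNull n) : Tendsto (fun k => (conjAvg (shiftS m) ^ k) x) atTop (𝓝 0) := by
  induction m generalizing x with
  | zero => exact h
  | succ m ih =>
    refine tendsto_zero_of_corners (fun k => conjAvg_pow_nonneg _ k hx) fun i => ?_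
    simp only [star_S_mul_conjAvg_shiftS_pow_mul_S]
    exact ih (star_left_conjugate_nonneg hx _) (star_S_mul_mul_S_mem_avgNull i hx h)

/-- The averages over φ^m(S_i) fix y, contract y - x and send x to 0; the inequality is their limit.
-/
theorem norm_le_of_mem_coreLevel (hn : n ≠ 0) {m : ℕ} {x y : CuntzAlgebra n} (hx : 0 ≤ x)
    (h : x ∈ avgNull n) (hy : y ∈ coreLevel n m) : ‖y‖ ≤ ‖y - x‖ := by
  have h1 : ∀ k, (conjAvg (shiftS m) ^ k) y = y := fun k => by
    induction k with
    | zero => simp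
    | succ k ih =>
      rw [pow_succ, Module.End.mul_apply, conjAvg_shiftS_of_mem_coreLevel hn hy, ih]
  have h2 : Tendsto (fun k => ‖y - (conjAvg (shiftS m) ^ k) x‖) atTop (𝓝 ‖y‖) := by
    simpa using ((tendsto_conjAvg_shiftS_pow m hx h).const_sub y).norm
  refine le_of_tendsto' h2 fun k => ?_
  nth_rewrite 1 [← h1 k]
  rw [← map_sub]
  exact norm_conjAvg_pow_le (norm_shiftS_le m) k _

/-! ### The gauge action and its means over roots of unity -/

theorem _root_.Circle.star_coe_mul_self (z : Circle) : star (z : ℂ) * z = 1 := by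
  simp [← Complex.normSq_eq_conj_mul_self]

/-- A scalar of modulus one as a unitary of `𝒪ₙ`. -/
def scalarUnitary (n : ℕ) (z : Circle) : unitary (CuntzAlgebra n) :=
  ⟨algebraMap ℂ _ z, by
    have h := z.star_coe_mul_self
    rw [Unitary.mem_iff, ← algebraMap_star_comm, ← map_mul, ← map_mul, mul_comm (z : ℂ), h,
      map_one, and_self]⟩

/-- The gauge action of the circle. -/
def gauge (z : Circle) : CuntzAlgebra n →⋆ₐ[ℂ] CuntzAlgebra n := lam (scalarUnitary n z)

theorem gauge_S (z : Circle) (i : Fin n) : gauge z (S i) = (z : ℂ) • S i := by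
  rw [gauge, lam_S, Algebra.smul_def]; rfl

theorem gauge_word (z : Circle) (μ : List (Fin n)) :
    gauge z (word μ) = ((z : ℂ) ^ μ.length) • word μ := by
  induction μ with
  | nil => simp
  | cons i μ ih =>
    rw [word_cons, map_mul, ih, gauge_S, smul_mul_smul_comm, List.length_cons, pow_succ']

theorem gauge_word_mul_star_word (z : Circle) (α β : List (Fin n)) :
    gauge z (word α * star (word β)) =
      ((z : ℂ) ^ α.length * star (z : ℂ) ^ β.length) • (word α * star (word β)) := by
  rw [map_mul, map_star, gauge_word, gauge_word, star_smul, smul_mul_smul_comm, star_pow]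

theorem norm_gauge_le (z : Circle) (x : CuntzAlgebra n) : ‖gauge z x‖ ≤ ‖x‖ :=
  NonUnitalStarAlgHom.norm_apply_le (gauge z) x

/-- Each term has one S_i* and one S_i, whose phases cancel. -/
theorem gauge_conjAvg (z : Circle) (x : CuntzAlgebra n) :
    gauge z (conjAvg S x) = conjAvg S (gauge z x) := by
  have h := z.star_coe_mul_self
  simp only [conjAvg_apply, map_smul, map_sum, map_mul, map_star, gauge_S, star_smul,
    smul_mul_assoc, mul_smul_comm, smul_smul, mul_comm (z : ℂ), h, one_smul]

theorem gauge_mem_avgNull (z : Circle) {x : CuntzAlgebra n} (h : x ∈ avgNull n) :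
    gauge z x ∈ avgNull n := by
  have h1 : ∀ k, (conjAvg S ^ k) (gauge z x) = gauge z ((conjAvg S ^ k) x) := fun k => by
    induction k with
    | zero => simp
    | succ k ih => rw [pow_succ', Module.End.mul_apply, ih, Module.End.mul_apply, gauge_conjAvg]
  rw [mem_avgNull]
  refine squeeze_zero_norm (fun k => ?_) (by simpa using (mem_avgNull.1 h).norm)
  rw [h1]
  exact norm_gauge_le _ _

theorem gauge_nonneg (z : Circle) {x : CuntzAlgebra n} (h : 0 ≤ x) : 0 ≤ gauge z x := by
  obtain ⟨a, rfl⟩ := CStarAlgebra.nonneg_iff_eq_star_mul_self.1 h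
  rw [map_mul, map_star]
  exact star_mul_self_nonneg _

/-- The linear span of the words `S_α S_β*`. -/
def wordSpan (n : ℕ) : Submodule ℂ (CuntzAlgebra n) :=
  Submodule.span ℂ (Set.range fun p : List (Fin n) × List (Fin n) => word p.1 * star (word p.2))

theorem S_mul_mem_wordSpan (i : Fin n) {x : CuntzAlgebra n} (hx : x ∈ wordSpan n) :
    S i * x ∈ wordSpan n := by
  induction hx using Submodule.span_induction with
  | zero => simp
  | add a b _ _ ha hb => rw [mul_add]; exact add_mem ha hb
  | smul c a _ ha => rw [mul_smul_comm]; exact Submodule.smul_mem _ _ ha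
  | mem a ha =>
    obtain ⟨⟨α, β⟩, rfl⟩ := ha
    exact Submodule.subset_span ⟨(i :: α, β), by simp only [word_cons, mul_assoc]⟩

theorem star_S_mul_mem_wordSpan (i : Fin n) {x : CuntzAlgebra n} (hx : x ∈ wordSpan n) :
    star (S i) * x ∈ wordSpan n := by
  induction hx using Submodule.span_induction with
  | zero => simp
  | add a b _ _ ha hb => rw [mul_add]; exact add_mem ha hb
  | smul c a _ ha => rw [mul_smul_comm]; exact Submodule.smul_mem _ _ ha
  | mem a ha =>
    obtain ⟨⟨α, β⟩, rfl⟩ := ha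
    obtain _ | ⟨j, α⟩ := α
    · exact Submodule.subset_span ⟨([], β ++ [i]), by simp [word_append, word_cons]⟩
    · simp only [word_cons, ← mul_assoc, star_S_mul_S_eq_ite]
      split_ifs
      · rw [one_mul]; exact Submodule.subset_span ⟨(α, β), rfl⟩
      · simp

theorem exists_mem_wordSpan_norm_sub_lt (x : CuntzAlgebra n) {ε : ℝ} (hε : 0 < ε) :
    ∃ q ∈ wordSpan n, ‖x - q‖ < ε := by
  have hx : x ∈ (StarAlgebra.adjoin ℂ (Set.range (S (n := n)))).topologicalClosure := by
    rw [adjoin_S_topologicalClosure]; exact StarSubalgebra.mem_top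
  obtain ⟨q, hq, h⟩ := Metric.mem_closure_iff.1 hx ε hε
  refine ⟨q, ?_, by rwa [dist_eq_norm] at h⟩
  clear h
  -- The induction proves that left multiplication by q preserves the span, so products need no
  -- reduction to words; applying q to 1 then recovers q.
  have h1 : ∀ y ∈ wordSpan n, q * y ∈ wordSpan n := by
    replace hq : q ∈ Algebra.adjoin ℂ (Set.range (S (n := n)) ∪ star (Set.range (S (n := n)))) := hq
    induction hq using Algebra.adjoin_induction with
    | mem a ha =>
      rcases ha with ⟨i, rfl⟩ | ⟨i, hi⟩
      · exact fun y hy => S_mul_mem_wordSpan i hy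
      · rw [← star_star a, ← hi]
        exact fun y hy => star_S_mul_mem_wordSpan i hy
    | algebraMap c =>
      intro y hy
      rw [← Algebra.smul_def]
      exact Submodule.smul_mem _ _ hy
    | add a b _ _ ha hb => exact fun y hy => by rw [add_mul]; exact add_mem (ha y hy) (hb y hy)
    | mul a b _ _ ha hb => exact fun y hy => by rw [mul_assoc]; exact ha _ (hb y hy)
  simpa using h1 1 (Submodule.subset_span ⟨([], []), by simp⟩)

theorem continuous_gauge_of_mem_wordSpan {q : CuntzAlgebra n} (hq : q ∈ wordSpan n) :
    Continuous fun z : Circle => gauge z q := by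
  induction hq using Submodule.span_induction with
  | zero => simpa using continuous_const
  | add a b _ _ ha hb => simp only [map_add]; exact ha.add hb
  | smul c a _ ha => simp only [map_smul]; exact ha.const_smul c
  | mem a ha =>
    obtain ⟨⟨α, β⟩, rfl⟩ := ha
    simp only [gauge_word_mul_star_word]
    fun_prop

theorem gauge_one (x : CuntzAlgebra n) : gauge 1 x = x := by
  have : gauge 1 = StarAlgHom.id ℂ (CuntzAlgebra n) := hom_ext fun i => by simp [gauge_S]
  rw [this]; rfl

theorem tendsto_gauge_one (x : CuntzAlgebra n) :
    Tendsto (fun z : Circle => gauge z x) (𝓝 1) (𝓝 x) := by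
  rw [Metric.tendsto_nhds]
  intro ε hε
  obtain ⟨q, hq, hxq⟩ := exists_mem_wordSpan_norm_sub_lt x (ε := ε / 3) (by positivity)
  have h1 : Tendsto (fun z : Circle => gauge z q) (𝓝 1) (𝓝 q) := by
    simpa only [gauge_one] using (continuous_gauge_of_mem_wordSpan hq).tendsto 1
  filter_upwards [Metric.tendsto_nhds.1 h1 (ε / 3) (by positivity)] with z hz
  rw [dist_eq_norm] at hz ⊢
  calc ‖gauge z x - x‖ = ‖gauge z (x - q) + (gauge z q - q) + -(x - q)‖ := by
        rw [map_sub]; congr 1; abel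
    _ ≤ ‖gauge z (x - q)‖ + ‖gauge z q - q‖ + ‖-(x - q)‖ := norm_add₃_le
    _ ≤ ‖x - q‖ + ‖gauge z q - q‖ + ‖x - q‖ := by
        rw [norm_neg]; gcongr; exact norm_gauge_le _ _
    _ < ε := by linarith

/-- The `M`-th root of unity `exp(2πi/M)`. -/
def rootOfUnity (M : ℕ) : Circle := Circle.exp (2 * Real.pi / M)

theorem isPrimitiveRoot_rootOfUnity {M : ℕ} (hM : M ≠ 0) :
    IsPrimitiveRoot (rootOfUnity M : ℂ) M := by
  have := Complex.isPrimitiveRoot_exp M hM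
  convert this using 1
  rw [rootOfUnity, Circle.coe_exp]
  congr 1
  push_cast
  ring

/-- The average of `x` over the action of the `M`-th roots of unity. -/
def gaugeMean (M : ℕ) : CuntzAlgebra n →ₗ[ℂ] CuntzAlgebra n :=
  (M : ℂ)⁻¹ • ∑ j ∈ Finset.range M,
    ((gauge (rootOfUnity M ^ j) : CuntzAlgebra n →⋆ₐ[ℂ] CuntzAlgebra n) :
      CuntzAlgebra n →ₗ[ℂ] CuntzAlgebra n)

theorem gaugeMean_apply (M : ℕ) (x : CuntzAlgebra n) :
    gaugeMean M x = (M : ℂ)⁻¹ • ∑ j ∈ Finset.range M, gauge (rootOfUnity M ^ j) x := by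
  simp [gaugeMean, LinearMap.sum_apply]

theorem norm_gaugeMean_le (M : ℕ) (x : CuntzAlgebra n) : ‖gaugeMean M x‖ ≤ ‖x‖ := by
  rw [gaugeMean_apply, norm_smul, norm_inv, Complex.norm_natCast]
  have h : ‖∑ j ∈ Finset.range M, gauge (rootOfUnity M ^ j) x‖ ≤ M * ‖x‖ :=
    (norm_sum_le_of_le _ (n := fun _ => ‖x‖) fun j _ => norm_gauge_le _ _).trans (by simp)
  rcases Nat.eq_zero_or_pos M with h0 | h0
  · subst h0; simp
  · rwa [inv_mul_le_iff₀ (by positivity)]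

theorem gaugeMean_mem_avgNull (M : ℕ) {x : CuntzAlgebra n} (h : x ∈ avgNull n) :
    gaugeMean M x ∈ avgNull n := by
  rw [gaugeMean_apply]
  exact Submodule.smul_mem _ _ (Submodule.sum_mem _ fun j _ => gauge_mem_avgNull _ h)

/-- The mean is a geometric sum in r = z^{|α| - |β|}. The lengths are distinct and below M, so r is
an M-th root of unity other than 1. -/
theorem gaugeMean_word_mul_star_word_of_ne {M : ℕ} {α β : List (Fin n)} (hα : α.length < M)
    (hβ : β.length < M) (h : α.length ≠ β.length) :
    gaugeMean M (word α * star (word β)) = 0 := by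
  have hM : M ≠ 0 := by omega
  have hζ := isPrimitiveRoot_rootOfUnity hM
  set z := rootOfUnity M
  set r : ℂ := (z : ℂ) ^ α.length * star (z : ℂ) ^ β.length with hr
  have hrM : r ^ M = 1 := by
    rw [hr, mul_pow, ← pow_mul, ← pow_mul, mul_comm _ M, mul_comm _ M, pow_mul, pow_mul,
      ← star_pow, hζ.pow_eq_one]
    simp
  have hr1 : r ≠ 1 := fun h2 => h <| hζ.pow_inj hα hβ <| by
    calc (z : ℂ) ^ α.length = r * (z : ℂ) ^ β.length := by
          rw [hr, mul_assoc, ← mul_pow, Circle.star_coe_mul_self, one_pow, mul_one]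
      _ = (z : ℂ) ^ β.length := by rw [h2, one_mul]
  have h2 : ∑ j ∈ Finset.range M, r ^ j = 0 := by
    have := geom_sum_mul r M
    rw [hrM, sub_self] at this
    exact (mul_eq_zero.1 this).resolve_right (sub_ne_zero.2 hr1)
  have h3 : ∀ j, gauge (z ^ j) (word α * star (word β)) =
      r ^ j • (word α * star (word β)) := fun j => by
    rw [gauge_word_mul_star_word, Circle.coe_pow, hr, mul_pow, star_pow, ← pow_mul,
      ← pow_mul, ← pow_mul, ← pow_mul, mul_comm j, mul_comm j]
  rw [gaugeMean_apply]
  simp only [z, h3, ← Finset.sum_smul, h2, zero_smul, smul_zero]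

theorem gaugeMean_word_mul_star_word_of_eq {M : ℕ} (hM : M ≠ 0) {α β : List (Fin n)}
    (h : α.length = β.length) :
    gaugeMean M (word α * star (word β)) = word α * star (word β) := by
  have h1 : ∀ z : Circle, (z : ℂ) * star (z : ℂ) = 1 := fun z => by
    rw [mul_comm, z.star_coe_mul_self]
  have hM' : (M : ℂ) ≠ 0 := Nat.cast_ne_zero.2 hM
  rw [gaugeMean_apply]
  simp only [gauge_word_mul_star_word, h, ← mul_pow, h1, one_pow, one_smul, Finset.sum_const,
    Finset.card_range]
  rw [← Nat.cast_smul_eq_nsmul ℂ, smul_smul, inv_mul_cancel₀ hM', one_smul]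

theorem eventually_gaugeMean_mem_coreLevel {q : CuntzAlgebra n} (hq : q ∈ wordSpan n) :
    ∃ m, ∀ M, m ≤ M → gaugeMean M q ∈ coreLevel n m := by
  -- Level and order vary independently above one threshold, so that sums are handled by a maximum;
  -- they are tied together only at the end.
  have : ∃ N, ∀ m, N ≤ m → ∀ M, N ≤ M → gaugeMean M q ∈ coreLevel n m := by
    induction hq using Submodule.span_induction with
    | zero => exact ⟨0, by simp⟩
    | add a b _ _ ha hb =>
      obtain ⟨N, hN⟩ := ha
      obtain ⟨K, hK⟩ := hb
      refine ⟨max N K, fun m hm M hM => ?_⟩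
      rw [map_add]
      exact add_mem (hN m (by omega) M (by omega)) (hK m (by omega) M (by omega))
    | smul c a _ ha =>
      obtain ⟨N, hN⟩ := ha
      refine ⟨N, fun m hm M hM => ?_⟩
      rw [map_smul]
      exact Submodule.smul_mem _ _ (hN m hm M hM)
    | mem a ha =>
      obtain ⟨⟨α, β⟩, rfl⟩ := ha
      refine ⟨α.length + β.length + 1, fun m hm M hM => ?_⟩
      by_cases h : α.length = β.length
      · rw [gaugeMean_word_mul_star_word_of_eq (by omega) h]
        exact coreLevel_mono (show α.length ≤ m by omega)
          (Submodule.subset_span ⟨α, β, rfl, h.symm, rfl⟩)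
      · rw [gaugeMean_word_mul_star_word_of_ne (show α.length < M by omega)
          (show β.length < M by omega) h]
        exact zero_mem _
  obtain ⟨N, hN⟩ := this
  exact ⟨N, hN N le_rfl⟩

/-- The averages of a positive element over roots of unity are bounded below, uniformly in the
order of the roots. -/
theorem exists_le_norm_gaugeMean {x : CuntzAlgebra n} (hx : 0 ≤ x) :
    ∃ K : ℕ, 0 < K ∧ ∀ L : ℕ, 0 < L → ‖x‖ / 2 / K ≤ ‖gaugeMean (K * L) x‖ := by
  rcases eq_or_ne x 0 with h0 | h0
  · exact ⟨1, one_pos, fun L _ => by simp [h0]⟩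
  have hx0 : 0 < ‖x‖ := norm_pos_iff.2 h0
  have h1 : Tendsto (fun t : ℝ => gauge (Circle.exp t) x) (𝓝 0) (𝓝 x) := by
    refine (tendsto_gauge_one x).comp ?_
    simpa using Circle.exp.continuous.tendsto 0
  obtain ⟨δ, hδ, h2⟩ := Metric.eventually_nhds_iff.1
    (Metric.tendsto_nhds.1 h1 (‖x‖ / 2) (half_pos hx0))
  -- With this K the first L of the K L roots lie on an arc of length below δ, where the gauge
  -- action moves x by at most ‖x‖/2.
  obtain ⟨K, hK⟩ := exists_nat_gt (2 * Real.pi / δ)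
  have hK0 : (0 : ℝ) < K := lt_trans (by positivity) hK
  refine ⟨K, by exact_mod_cast hK0, fun L hL => ?_⟩
  have hL' : (0 : ℝ) < L := by exact_mod_cast hL
  have h3 : ∀ j ∈ Finset.range L, ‖gauge (rootOfUnity (K * L) ^ j) x - x‖ ≤ ‖x‖ / 2 := by
    intro j hj
    have hj' : (j : ℝ) < L := by exact_mod_cast Finset.mem_range.1 hj
    have h4 : rootOfUnity (K * L) ^ j = Circle.exp (j * (2 * Real.pi / (K * L))) := by
      rw [rootOfUnity]
      push_cast
      exact (Circle.exp_natCast_mul _ j).symm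
    rw [h4, ← dist_eq_norm]
    refine (h2 ?_).le
    rw [dist_zero_right, Real.norm_of_nonneg (by positivity)]
    rw [div_lt_iff₀ hδ] at hK
    calc (j : ℝ) * (2 * Real.pi / (K * L)) ≤ L * (2 * Real.pi / (K * L)) := by gcongr
      _ = 2 * Real.pi / K := by field_simp
      _ < δ := by rw [div_lt_iff₀ hK0]; linarith
  have h5 : L * ‖x‖ - L * (‖x‖ / 2) ≤ ‖∑ j ∈ Finset.range L, gauge (rootOfUnity (K * L) ^ j) x‖ := by
    have h6 : ‖∑ j ∈ Finset.range L, (gauge (rootOfUnity (K * L) ^ j) x - x)‖ ≤ L * (‖x‖ / 2) :=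
      (norm_sum_le_of_le _ h3).trans (by simp)
    rw [Finset.sum_sub_distrib, Finset.sum_const, Finset.card_range] at h6
    have h7 : ‖L • x‖ = L * ‖x‖ := by
      rw [← Nat.cast_smul_eq_nsmul ℝ, norm_smul]; simp
    have h8 := norm_sub_norm_le (L • x) (∑ j ∈ Finset.range L, gauge (rootOfUnity (K * L) ^ j) x)
    rw [norm_sub_rev, h7] at h8
    linarith
  -- The terms beyond the arc are positive, so they cannot cancel the first L.
  have h9 : ‖∑ j ∈ Finset.range L, gauge (rootOfUnity (K * L) ^ j) x‖ ≤
      ‖∑ j ∈ Finset.range (K * L), gauge (rootOfUnity (K * L) ^ j) x‖ := by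
    refine CStarAlgebra.norm_le_norm_of_nonneg_of_le
      (Finset.sum_nonneg fun j _ => gauge_nonneg _ hx)
      (Finset.sum_le_sum_of_subset_of_nonneg ?_ fun j _ _ => gauge_nonneg _ hx)
    exact Finset.range_mono (Nat.le_mul_of_pos_left _ (by exact_mod_cast hK0))
  rw [gaugeMean_apply, norm_smul, norm_inv, Complex.norm_natCast, Nat.cast_mul,
    inv_mul_eq_div, div_div, div_le_div_iff₀ (by positivity) (by positivity)]
  have h10 := h5.trans h9
  nlinarith

/-- The limit of the iterated averages is faithful on positive elements. -/
theorem eq_zero_of_nonneg_of_mem_avgNull {x : CuntzAlgebra n} (hn : n ≠ 0) (hx : 0 ≤ x)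
    (h : x ∈ avgNull n) : x = 0 := by
  by_contra h0
  have hx0 : 0 < ‖x‖ := norm_pos_iff.2 h0
  obtain ⟨K, hK, h1⟩ := exists_le_norm_gaugeMean hx
  have hK' : (0 : ℝ) < K := by exact_mod_cast hK
  obtain ⟨q, hq, hxq⟩ := exists_mem_wordSpan_norm_sub_lt x (ε := ‖x‖ / 8 / K) (by positivity)
  obtain ⟨m, hm⟩ := eventually_gaugeMean_mem_coreLevel hq
  -- The order must be a multiple of K, for the lower bound, and at least m, for the mean of q to
  -- lie in level m. The mean of x then has norm at most 2‖x - q‖ < ‖x‖/(4K), against the lower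
  -- bound ‖x‖/(2K).
  have h2 := hm (K * (m + 1)) (by nlinarith)
  set M := K * (m + 1)
  have hf : 0 ≤ gaugeMean M x := by
    have : gaugeMean M x = (M : ℝ)⁻¹ • ∑ j ∈ Finset.range M, gauge (rootOfUnity M ^ j) x := by
      rw [gaugeMean_apply, ← Complex.coe_smul]; simp
    rw [this]
    exact smul_nonneg (by positivity) (Finset.sum_nonneg fun j _ => gauge_nonneg _ hx)
  have h3 := norm_le_of_mem_coreLevel hn hf (gaugeMean_mem_avgNull M h) h2
  have h4 : ‖gaugeMean M q - gaugeMean M x‖ ≤ ‖x - q‖ := by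
    rw [norm_sub_rev, ← map_sub]; exact norm_gaugeMean_le _ _
  have h5 := h1 (m + 1) (Nat.succ_pos _)
  have h6 : ‖gaugeMean M x‖ ≤ ‖gaugeMean M q‖ + ‖gaugeMean M q - gaugeMean M x‖ :=
    norm_le_insert _ _
  have h7 : ‖x‖ / 2 / K = 4 * (‖x‖ / 8 / K) := by ring
  have h8 : 0 < ‖x‖ / 8 / K := by positivity
  change _ ≤ ‖gaugeMean M x‖ at h5
  linarith

end CuntzAlgebra

end

/-! ### Finite-dimensional λ_w(𝒟ₙ)Q forces small trace -/

noncomputable section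

open Filter Topology

namespace CuntzAlgebra

variable {n : ℕ}

theorem sum_proj_ofFn (k : ℕ) :
    ∑ f : Fin k → Fin n, proj (List.ofFn f) = (1 : CuntzAlgebra n) := by
  induction k with
  | zero => simp [proj]
  | succ k ih =>
    rw [← (Fin.consEquiv fun _ : Fin (k + 1) => Fin n).sum_comp, Fintype.sum_prod_type]
    have h : ∀ (i : Fin n) (f : Fin k → Fin n),
        proj (List.ofFn ((Fin.consEquiv fun _ : Fin (k + 1) => Fin n) (i, f))) =
          S i * proj (List.ofFn f) * star (S i) := fun i f => by
      simp [proj, List.ofFn_succ, word_cons, mul_assoc]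
    simp only [h, ← Finset.mul_sum, ← Finset.sum_mul, ih, mul_one, sum_S_mul_star]

theorem proj_mul_proj {μ ν : List (Fin n)} (h : μ.length = ν.length) :
    proj μ * proj ν = if μ = ν then proj μ else (0 : CuntzAlgebra n) := by
  have : proj μ * proj ν = word μ * (star (word μ) * word ν) * star (word ν) := by
    simp only [proj, mul_assoc]
  rw [this, star_word_mul_word h]
  split_ifs with h1
  · rw [mul_one, h1, proj]
  · simp

theorem star_proj (μ : List (Fin n)) : star (proj μ) = (proj μ : CuntzAlgebra n) := by
  simp [proj]

theorem proj_mem_diagonal (μ : List (Fin n)) : proj μ ∈ diagonal n :=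
  StarSubalgebra.le_topologicalClosure _ (StarAlgebra.subset_adjoin ℂ _ ⟨μ, rfl⟩)

attribute [local instance] CStarAlgebra.spectralOrder CStarAlgebra.spectralOrderedRing

/-- If `ρ(𝒟ₙ) Q` has dimension `d`, then the projection `Q` lies below the sum of the images of at
most `d` of the projections `P_μ` with `|μ| = k`. -/
theorem exists_le_sum_proj (ρ : CuntzAlgebra n →⋆ₐ[ℂ] CuntzAlgebra n) {Q : CuntzAlgebra n}
    (hQ : IsStarProjection Q) [FiniteDimensional ℂ (diagonalImageMul ρ Q)] (k : ℕ) :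
    ∃ A : Finset (Fin k → Fin n), A.card ≤ Module.finrank ℂ (diagonalImageMul ρ Q) ∧
      Q ≤ ∑ f ∈ A, ρ (proj (List.ofFn f)) := by
  classical
  set p : (Fin k → Fin n) → CuntzAlgebra n := fun f => ρ (proj (List.ofFn f)) with hp
  have hpp : ∀ f g, p f * p g = if f = g then p f else 0 := fun f g => by
    rw [hp]
    simp only
    rw [← map_mul, proj_mul_proj (by simp)]
    simp only [List.ofFn_inj]
    split_ifs <;> simp
  set A := Finset.univ.filter fun f => p f * Q ≠ 0 with hA
  refine ⟨A, ?_, ?_⟩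
  · let v : A → diagonalImageMul ρ Q := fun f => ⟨p f * Q, _, proj_mem_diagonal _, rfl⟩
    -- The nonzero p_f Q are independent because multiplying a relation by p_f isolates one
    -- coefficient; this bounds the size of A.
    have hv : LinearIndependent ℂ v := by
      rw [Fintype.linearIndependent_iff]
      intro c hc f
      have h1 : ∑ g : A, c g • (p g * Q) = 0 := by
        simpa [v] using congrArg Subtype.val hc
      have h2 : p f * ∑ g : A, c g • (p g * Q) = c f • (p f * Q) := by
        rw [Finset.mul_sum, Finset.sum_eq_single f]
        · rw [mul_smul_comm, ← mul_assoc, hpp, if_pos rfl]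
        · intro g _ hg
          rw [mul_smul_comm, ← mul_assoc, hpp, if_neg fun h => hg (Subtype.ext h.symm), zero_mul,
            smul_zero]
        · simp
      rw [h1, mul_zero] at h2
      exact (smul_eq_zero.1 h2.symm).resolve_right (Finset.mem_filter.1 f.2).2
    simpa using hv.fintype_card_le_finrank
  · set E := ∑ f ∈ A, p f with hE
    have hEQ : E * Q = Q := by
      calc E * Q = ∑ f, p f * Q := by
            rw [hE, Finset.sum_mul]
            exact Finset.sum_filter_ne_zero Finset.univ
        _ = Q := by rw [← Finset.sum_mul, hp, ← map_sum, sum_proj_ofFn, map_one, one_mul]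
    have hEs : star E = E := by
      simp [hE, hp, star_sum, ← map_star, star_proj]
    have hEE : E * E = E := by
      rw [hE, Finset.sum_mul_sum]
      refine Finset.sum_congr rfl fun f hf => ?_
      simp [hpp, hf]
    have hQE : Q * E = Q := by
      have := congrArg star hEQ
      rwa [star_mul, hEs, hQ.isSelfAdjoint.star_eq] at this
    have h : E - Q = star (E - Q) * (E - Q) := by
      rw [star_sub, hEs, hQ.isSelfAdjoint.star_eq, sub_mul, mul_sub, mul_sub, hEE, hEQ, hQE,
        hQ.isIdempotentElem.eq]
      abel
    rw [← sub_nonneg, h]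
    exact star_mul_self_nonneg _

theorem not_finiteDimensional_diagonalImageMul_lam (hn : 2 ≤ n) {w : unitary (CuntzAlgebra n)}
    (hw : (w : CuntzAlgebra n) ∈ core n) {Q : CuntzAlgebra n} (hQ : IsStarProjection Q)
    (hQ0 : Q ≠ 0) : ¬ FiniteDimensional ℂ (diagonalImageMul (lam w) Q) := by
  intro hfin
  refine hQ0 (eq_zero_of_nonneg_of_mem_avgNull (by omega) hQ.nonneg ?_)
  set d := Module.finrank ℂ (diagonalImageMul (lam w) Q)
  rw [mem_avgNull, Metric.tendsto_atTop]
  intro ε hε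
  have hn1 : (n : ℝ)⁻¹ < 1 := inv_lt_one_of_one_lt₀ (by exact_mod_cast hn)
  -- The bound d does not depend on k, so d n^{-k} can be made small; this is where n ≥ 2 enters.
  obtain ⟨k, hk⟩ : ∃ k : ℕ, (d : ℝ) * ((n : ℝ)⁻¹ ^ k) < ε / 2 := by
    have h := (tendsto_pow_atTop_nhds_zero_of_lt_one (by positivity) hn1).const_mul (d : ℝ)
    rw [mul_zero] at h
    exact (h.eventually_lt_const (half_pos hε)).exists
  obtain ⟨A, hA, hQA⟩ := exists_le_sum_proj (lam w) hQ k
  have h1 : ∑ f ∈ A, lam w (proj (List.ofFn f)) -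
      ((A.card : ℂ) * (n : ℂ)⁻¹ ^ k) • (1 : CuntzAlgebra n) ∈ avgNull n := by
    rw [mul_smul, Nat.cast_smul_eq_nsmul, ← Finset.sum_const, ← Finset.sum_sub_distrib]
    refine Submodule.sum_mem _ fun f _ => ?_
    simpa using lam_proj_sub_mem_avgNull hw (List.ofFn f)
  set E := ∑ f ∈ A, lam w (proj (List.ofFn f))
  obtain ⟨N, hN⟩ := Metric.tendsto_atTop.1 (mem_avgNull.1 h1) (ε / 2) (half_pos hε)
  refine ⟨N, fun j hj => ?_⟩
  have h2 := hN j hj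
  rw [dist_zero_right] at h2 ⊢
  have : Nontrivial (CuntzAlgebra n) := ⟨Q, 0, hQ0⟩
  have h3 : ‖((A.card : ℂ) * (n : ℂ)⁻¹ ^ k) • (1 : CuntzAlgebra n)‖ < ε / 2 := by
    rw [norm_smul, norm_mul, norm_pow, norm_inv, Complex.norm_natCast, Complex.norm_natCast,
      norm_one, mul_one]
    refine lt_of_le_of_lt ?_ hk
    gcongr
  calc ‖(conjAvg S ^ j) Q‖ ≤ ‖(conjAvg S ^ j) E‖ :=
        CStarAlgebra.norm_le_norm_of_nonneg_of_le (conjAvg_pow_nonneg _ _ hQ.nonneg)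
          (conjAvg_pow_mono _ _ hQA)
    _ = ‖(conjAvg S ^ j) (E - ((A.card : ℂ) * (n : ℂ)⁻¹ ^ k) • (1 : CuntzAlgebra n)) +
          (conjAvg S ^ j) (((A.card : ℂ) * (n : ℂ)⁻¹ ^ k) • (1 : CuntzAlgebra n))‖ := by
        rw [← map_add, sub_add_cancel]
    _ ≤ _ := norm_add_le _ _
    _ < ε / 2 + ε / 2 :=
        add_lt_add h2 ((norm_conjAvg_pow_le norm_S_le j _).trans_lt h3)
    _ = ε := add_halves ε

end CuntzAlgebra

end

/-! ### A Cuntz family on ℓ²(ℕ) -/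

noncomputable section

section Existence

variable {H : Type*} [NormedAddCommGroup H] [InnerProductSpace ℂ H]

theorem HilbertBasis.continuousLinearMap_ext (b : HilbertBasis ℕ ℂ H) {f g : H →L[ℂ] H}
    (h : ∀ m, f (b m) = g (b m)) : f = g :=
  ContinuousLinearMap.ext_on (s := Set.range b)
    (Submodule.dense_iff_topologicalClosure_eq_top.2 b.dense_span) (by rintro _ ⟨m, rfl⟩; exact h m)

variable [CompleteSpace H]

/-- The isometry of a Hilbert space with basis `b` that maps `b m` to `b (g m)`. -/
def HilbertBasis.shift (b : HilbertBasis ℕ ℂ H) {g : ℕ → ℕ} (hg : Function.Injective g) :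
    H →L[ℂ] H :=
  ((b.orthonormal.comp g hg).orthogonalFamily.linearIsometry.comp
    b.repr.toLinearIsometry).toContinuousLinearMap

theorem HilbertBasis.shift_apply (b : HilbertBasis ℕ ℂ H) {g : ℕ → ℕ}
    (hg : Function.Injective g) (m : ℕ) : b.shift hg (b m) = b (g m) := by
  change (b.orthonormal.comp g hg).orthogonalFamily.linearIsometry (b.repr (b m)) = _
  rw [b.repr_self, OrthogonalFamily.linearIsometry_apply_single]
  simp

theorem HilbertBasis.star_shift_mul_self (b : HilbertBasis ℕ ℂ H) {g : ℕ → ℕ}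
    (hg : Function.Injective g) : star (b.shift hg) * b.shift hg = 1 :=
  (ContinuousLinearMap.norm_map_iff_adjoint_comp_self _).1 fun x => LinearIsometry.norm_map _ x

theorem HilbertBasis.star_shift_apply (b : HilbertBasis ℕ ℂ H) {g : ℕ → ℕ}
    (hg : Function.Injective g) (m : ℕ) : star (b.shift hg) (b (g m)) = b m := by
  rw [← b.shift_apply hg]
  exact congrArg (fun f : H →L[ℂ] H => f (b m)) (b.star_shift_mul_self hg)

theorem HilbertBasis.star_shift_apply_of_notMem (b : HilbertBasis ℕ ℂ H) {g : ℕ → ℕ}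
    (hg : Function.Injective g) {k : ℕ} (hk : k ∉ Set.range g) :
    star (b.shift hg) (b k) = 0 := by
  refine b.repr.injective (lp.ext (funext fun m => ?_))
  have h : inner ℂ (b m) (star (b.shift hg) (b k)) = inner ℂ (b.shift hg (b m)) (b k) :=
    ContinuousLinearMap.adjoint_inner_right _ _ _
  rw [b.repr_apply_apply, h, b.shift_apply, b.orthonormal.2 fun h => hk ⟨m, h⟩]
  simp

/-- The ranges of the maps e(i, ·) partition ℕ, so each basis vector is fixed by exactly one range
projection and killed by the others. -/
theorem HilbertBasis.sum_shift_mul_star_shift (b : HilbertBasis ℕ ℂ H) {n : ℕ}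
    (e : Fin n × ℕ ≃ ℕ) (g : Fin n → ℕ → ℕ) (hg : ∀ i, Function.Injective (g i))
    (hge : ∀ i m, g i m = e (i, m)) :
    ∑ i, b.shift (hg i) * star (b.shift (hg i)) = 1 := by
  refine b.continuousLinearMap_ext fun k => ?_
  obtain ⟨⟨j, m⟩, rfl⟩ := e.surjective k
  have h : ∀ i, (b.shift (hg i) * star (b.shift (hg i))) (b (e (j, m))) =
      if i = j then b (e (j, m)) else 0 := fun i => by
    change b.shift (hg i) (star (b.shift (hg i)) (b (e (j, m)))) = _
    split_ifs with hij
    · subst hij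
      rw [← hge, b.star_shift_apply, b.shift_apply]
    · rw [b.star_shift_apply_of_notMem, map_zero]
      rintro ⟨l, hl⟩
      rw [hge, e.apply_eq_iff_eq, Prod.mk.injEq] at hl
      exact hij hl.1
  rw [sum_apply, Finset.sum_congr rfl fun i _ => h i]
  simp

end Existence

/-- The space `ℓ²(ℕ)` carries a Cuntz family for every `n ≥ 1`. -/
theorem CuntzFamily.nonempty {n : ℕ} (hn : n ≠ 0) : Nonempty (CuntzFamily n) := by
  have : Nonempty (Fin n) := ⟨⟨0, Nat.pos_of_ne_zero hn⟩⟩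
  obtain ⟨e⟩ := nonempty_equiv_of_countable (α := Fin n × ℕ) (β := ℕ)
  let b : HilbertBasis ℕ ℂ (lp (fun _ : ℕ => ℂ) 2) :=
    HilbertBasis.ofRepr (LinearIsometryEquiv.refl ℂ _)
  have : Nontrivial (lp (fun _ : ℕ => ℂ) 2) := ⟨b 0, 0, b.orthonormal.ne_zero 0⟩
  have hg : ∀ i, Function.Injective fun m => e (i, m) := fun i x y h => by simpa using h
  exact ⟨{
    carrier := lp (fun _ : ℕ => ℂ) 2 →L[ℂ] lp (fun _ : ℕ => ℂ) 2
    gen := fun i => b.shift (hg i)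
    star_gen_mul_gen := fun i => b.star_shift_mul_self _
    sum_gen_mul_star := b.sum_shift_mul_star_shift e _ hg fun _ _ => rfl }⟩

/-! ### The exchange unitary and its one-dimensional image -/

namespace CuntzAlgebra

variable {n : ℕ}

theorem nontrivial (hn : n ≠ 0) : Nontrivial (CuntzAlgebra n) := by
  obtain ⟨T⟩ := CuntzFamily.nonempty hn
  exact (eval T).toRingHom.domain_nontrivial

theorem proj_ne_zero (hn : n ≠ 0) (μ : List (Fin n)) : (proj μ : CuntzAlgebra n) ≠ 0 := by
  have := nontrivial hn
  intro h
  have h1 : star (word μ) * proj μ * word μ = (1 : CuntzAlgebra n) := by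
    rw [proj, ← mul_assoc, star_word_mul_word_self, one_mul, star_word_mul_word_self]
  rw [h, mul_zero, zero_mul] at h1
  exact zero_ne_one h1

/-- The element `S_b S_{ab}* + S_{ab} S_b* + (1 - P_b - P_{ab})`, which exchanges the ranges of
`S_b` and `S_a S_b`. -/
def swapElem (a b : Fin n) : CuntzAlgebra n :=
  S b * star (S a * S b) + S a * S b * star (S b) +
    (1 - S b * star (S b) - S a * S b * star (S a * S b))

theorem star_swapElem (a b : Fin n) : star (swapElem a b) = swapElem a b := by
  simp only [swapElem, star_add, star_sub, star_mul, star_star, star_one]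
  abel

theorem swapElem_mul_left {a b : Fin n} (h : a ≠ b) : swapElem a b * (S a * S b) = S b := by
  have h1 : star (S a * S b) * (S a * S b) = (1 : CuntzAlgebra n) := by
    rw [star_mul, mul_assoc, ← mul_assoc (star (S a)), star_S_mul_S, one_mul, star_S_mul_S]
  have h2 : star (S b) * (S a * S b) = (0 : CuntzAlgebra n) := by
    rw [← mul_assoc, star_S_mul_S_of_ne h.symm, zero_mul]
  rw [swapElem]
  simp only [add_mul, sub_mul, mul_assoc _ (star _) (S a * S b), h1, h2, mul_one, mul_zero, one_mul]
  abel

theorem swapElem_mul_right {a b : Fin n} (h : a ≠ b) : swapElem a b * S b = S a * S b := by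
  have h2 : star (S a * S b) * S b = (0 : CuntzAlgebra n) := by
    rw [star_mul, mul_assoc, star_S_mul_S_of_ne h, mul_zero]
  rw [swapElem]
  simp only [add_mul, sub_mul, mul_assoc _ (star _) (S b), h2, star_S_mul_S, mul_one, mul_zero,
    one_mul]
  abel

theorem swapElem_mul_self {a b : Fin n} (h : a ≠ b) : swapElem a b * swapElem a b = 1 := by
  nth_rewrite 2 [swapElem]
  simp only [mul_add, mul_sub, ← mul_assoc (swapElem a b) (S b),
    ← mul_assoc (swapElem a b) (S a * S b), swapElem_mul_left h, swapElem_mul_right h, mul_one]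
  rw [swapElem]
  abel

/-- The unitary that exchanges the ranges of `S_b` and `S_a S_b`. -/
def swapUnitary {a b : Fin n} (h : a ≠ b) : unitary (CuntzAlgebra n) :=
  ⟨swapElem a b, by rw [Unitary.mem_iff, star_swapElem, swapElem_mul_self h, and_self]⟩

theorem swapUnitary_mem_wordUnitaries {a b : Fin n} (h : a ≠ b) :
    swapUnitary h ∈ wordUnitaries n := by
  classical
  have hf : Function.Injective fun j : Fin n => (([a, j], [a, j]) : List (Fin n) × List (Fin n)) :=
    fun i j h => by simpa using h
  have hg : Function.Injective fun j : Fin n => (([j], [j]) : List (Fin n) × List (Fin n)) :=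
    fun i j h => by simpa using h
  -- J₁ contributes P_a - P_{ab} and J₂ contributes 1 - P_a - P_b, which together give the remainder
  -- 1 - P_b - P_{ab}. Distinctness of the pairs is needed since the index is a finite set.
  set J₁ := (Finset.univ.erase b).image
    fun j : Fin n => (([a, j], [a, j]) : List (Fin n) × List (Fin n)) with hJ₁
  set J₂ := ((Finset.univ.erase a).erase b).image
    fun j : Fin n => (([j], [j]) : List (Fin n) × List (Fin n)) with hJ₂
  have h12 : Disjoint J₁ J₂ := by
    rw [Finset.disjoint_left]
    intro p h1 h2
    obtain ⟨i, -, rfl⟩ := Finset.mem_image.1 h1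
    obtain ⟨j, -, hj⟩ := Finset.mem_image.1 h2
    simp at hj
  have h1 : ([a, b], [b]) ∉ J₁ ∪ J₂ := by simp [J₁, J₂]
  have h2 : ([b], [a, b]) ∉ insert ([a, b], [b]) (J₁ ∪ J₂) := by simp [J₁, J₂]
  refine ⟨insert ([b], [a, b]) (insert ([a, b], [b]) (J₁ ∪ J₂)), ?_⟩
  have h3 : ∑ j ∈ Finset.univ.erase b, S a * S j * star (S a * S j) =
      S a * star (S a) - S a * S b * star (S a * S b) := by
    have : ∑ j, S a * S j * star (S a * S j) = S a * star (S a) := by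
      calc ∑ j, S a * S j * star (S a * S j) = S a * (∑ j, S j * star (S j)) * star (S a) := by
            simp only [star_mul, Finset.mul_sum, Finset.sum_mul, mul_assoc]
        _ = _ := by rw [sum_S_mul_star, mul_one]
    rw [← this, ← Finset.add_sum_erase _ _ (Finset.mem_univ b), add_sub_cancel_left]
  have h4 : ∑ j ∈ (Finset.univ.erase a).erase b, S j * star (S j) =
      1 - S a * star (S a) - S b * star (S b) := by
    rw [← sum_S_mul_star, ← Finset.add_sum_erase _ _ (Finset.mem_univ a),
      ← Finset.add_sum_erase _ _ (Finset.mem_erase.2 ⟨h.symm, Finset.mem_univ b⟩)]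
    abel
  rw [Finset.sum_insert h2, Finset.sum_insert h1, Finset.sum_union h12, hJ₁, hJ₂,
    Finset.sum_image hf.injOn, Finset.sum_image hg.injOn]
  simp only [word_cons, word_nil, mul_one]
  rw [h3, h4]
  change swapElem a b = _
  rw [swapElem]
  abel

/-- As λ_u(S_a) fixes S_b, its adjoint does too, and the adjoints of the other λ_u(S_j) kill S_b.
Only powers of the letter a survive. -/
theorem star_lam_word_mul {u : unitary (CuntzAlgebra n)} {a b : Fin n}
    (hu : lam u (S a) * S b = S b) (μ : List (Fin n)) :
    star (lam u (word μ)) * S b = 0 ∨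
      star (lam u (word μ)) * S b = S b ∧ lam u (word μ) * S b = S b := by
  induction μ with
  | nil => simp
  | cons j μ ih =>
    rw [word_cons, map_mul, star_mul, mul_assoc, mul_assoc]
    by_cases hj : j = a
    · have h1 : star (lam u (S j)) * S b = S b := by
        rw [hj]
        nth_rewrite 1 [← hu]
        rw [← mul_assoc, ← map_star, ← map_mul, star_S_mul_S, map_one, one_mul]
      rw [h1]
      refine ih.imp_right fun h => ⟨h.1, ?_⟩
      rw [h.2, hj, hu]
    · left
      have h1 : star (lam u (S j)) * S b = 0 := by
        rw [← hu, ← mul_assoc, ← map_star, ← map_mul, star_S_mul_S_of_ne hj, map_zero, zero_mul]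
      rw [h1, mul_zero]

/-- If `λ_u(S_a)` fixes `S_b`, then `λ_u(𝒟ₙ) P_b` is spanned by `P_b`. -/
theorem diagonalImageMul_eq_span {u : unitary (CuntzAlgebra n)} {a b : Fin n}
    (hu : lam u (S a) * S b = S b) :
    diagonalImageMul (lam u) (proj [b]) = Submodule.span ℂ {proj [b]} := by
  have hb : proj [b] = S b * star (S b) := by simp [proj, word_cons]
  apply le_antisymm
  · let T : Set (CuntzAlgebra n) :=
      {d | lam u d * proj [b] ∈ Submodule.span ℂ {(proj [b] : CuntzAlgebra n)}}
    have hT : IsClosed T :=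
      (Submodule.closed_of_finiteDimensional (Submodule.span ℂ {(proj [b] : CuntzAlgebra n)})).preimage
        (Continuous.mul (AddMonoidHomClass.continuous_of_bound (lam u) 1 fun x => by
          rw [one_mul]; exact NonUnitalStarAlgHom.norm_apply_le (lam u) x) continuous_const)
    have hproj : ∀ μ, proj μ ∈ T := fun μ => by
      have h1 : lam u (proj μ) * proj [b] =
          lam u (word μ) * (star (lam u (word μ)) * S b) * star (S b) := by
        rw [hb, proj, map_mul, map_star]; simp only [mul_assoc]
      change lam u (proj μ) * proj [b] ∈ Submodule.span ℂ {proj [b]}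
      rw [h1]
      rcases star_lam_word_mul hu μ with h | ⟨h, h'⟩
      · simp [h]
      · rw [h, h', ← hb]; exact Submodule.mem_span_singleton_self _
    have hadj : (StarAlgebra.adjoin ℂ (Set.range (proj (n := n))) : Set (CuntzAlgebra n)) ⊆ T := by
      intro d hd
      have hstar : star (Set.range (proj (n := n))) = Set.range proj := by
        ext x
        simp only [Set.mem_star, Set.mem_range]
        refine exists_congr fun μ => ?_
        rw [eq_star_iff_eq_star, star_proj, eq_comm]
      have hd' : d ∈ Algebra.adjoin ℂ (Set.range (proj (n := n)) ∪ star (Set.range proj)) := hd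
      rw [hstar, Set.union_self] at hd'
      clear hd
      induction hd' using Algebra.adjoin_induction with
      | mem x hx =>
        obtain ⟨μ, rfl⟩ := hx
        exact hproj μ
      | algebraMap c =>
        change lam u _ * proj [b] ∈ Submodule.span ℂ {proj [b]}
        rw [AlgHomClass.commutes, ← Algebra.smul_def]
        exact Submodule.smul_mem _ _ (Submodule.mem_span_singleton_self _)
      | add x y _ _ hx hy =>
        change lam u _ * proj [b] ∈ Submodule.span ℂ {proj [b]}
        rw [map_add, add_mul]
        exact add_mem hx hy
      | mul x y _ _ hx hy =>
        change lam u _ * proj [b] ∈ Submodule.span ℂ {proj [b]}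
        -- The right factor acts on P_b as a scalar, so the product acts as a multiple of the left
        -- factor.
        obtain ⟨c, hc⟩ := Submodule.mem_span_singleton.1 hy
        rw [map_mul, mul_assoc, ← hc, mul_smul_comm]
        exact Submodule.smul_mem _ _ hx
    rintro _ ⟨d, hd, rfl⟩
    exact closure_minimal hadj hT hd
  · rw [Submodule.span_singleton_le_iff_mem]
    exact ⟨1, one_mem (diagonal n), by simp⟩

theorem lam_swapUnitary_S_mul {a b : Fin n} (h : a ≠ b) :
    lam (swapUnitary h) (S a) * S b = S b := by
  rw [lam_S, mul_assoc]
  exact swapElem_mul_left h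

theorem finrank_diagonalImageMul_lam_swapUnitary {a b : Fin n} (h : a ≠ b) :
    Module.finrank ℂ (diagonalImageMul (lam (swapUnitary h)) (proj [b])) = 1 := by
  rw [diagonalImageMul_eq_span (lam_swapUnitary_S_mul h)]
  exact finrank_span_singleton (proj_ne_zero a.pos.ne' _)

theorem isStarProjection_proj (μ : List (Fin n)) :
    IsStarProjection (proj μ : CuntzAlgebra n) :=
  ⟨by rw [IsIdempotentElem, proj_mul_proj rfl, if_pos rfl], star_proj μ⟩

theorem diagonalImageMul_comp (ψ : CuntzAlgebra n ≃⋆ₐ[ℂ] CuntzAlgebra n)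
    (ρ : CuntzAlgebra n →⋆ₐ[ℂ] CuntzAlgebra n) (Q : CuntzAlgebra n) :
    diagonalImageMul ((ψ : CuntzAlgebra n →⋆ₐ[ℂ] CuntzAlgebra n).comp ρ) (ψ Q) =
      (diagonalImageMul ρ Q).map
        ((ψ : CuntzAlgebra n →⋆ₐ[ℂ] CuntzAlgebra n) : CuntzAlgebra n →ₗ[ℂ] CuntzAlgebra n) := by
  ext x
  rw [Submodule.mem_map]
  constructor
  · rintro ⟨d, hd, rfl⟩
    exact ⟨ρ d * Q, ⟨d, hd, rfl⟩, map_mul ψ _ _⟩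
  · rintro ⟨_, ⟨d, hd, rfl⟩, rfl⟩
    exact ⟨d, hd, (map_mul ψ _ _).symm⟩

/-- If λ_u = ψ ∘ λ_w, then ψ carries λ_w(𝒟ₙ)ψ⁻¹(Q) isomorphically onto λ_u(𝒟ₙ)Q, contradicting
infinite-dimensionality for w. -/
theorem lam_notMem_autMulLamCore (hn : 2 ≤ n) {u : unitary (CuntzAlgebra n)}
    {Q : CuntzAlgebra n} (hQ : IsStarProjection Q) (hQ0 : Q ≠ 0)
    [FiniteDimensional ℂ (diagonalImageMul (lam u) Q)] : lam u ∉ autMulLamCore n := by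
  rintro ⟨ψ, w, hw, h⟩
  have hψ : ψ (ψ.symm Q) = Q := ψ.apply_symm_apply Q
  have hQ' : IsStarProjection (ψ.symm Q) :=
    ⟨by rw [IsIdempotentElem, ← map_mul, hQ.isIdempotentElem.eq],
      by rw [IsSelfAdjoint, ← map_star, hQ.isSelfAdjoint.star_eq]⟩
  refine not_finiteDimensional_diagonalImageMul_lam hn hw hQ' (fun h0 => hQ0 ?_) ?_
  · rw [← hψ, h0, map_zero]
  · have h1 := diagonalImageMul_comp ψ (lam w) (ψ.symm Q)
    rw [← h, hψ] at h1
    have hinj : Function.Injective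
        ((ψ : CuntzAlgebra n →⋆ₐ[ℂ] CuntzAlgebra n) : CuntzAlgebra n →ₗ[ℂ] CuntzAlgebra n) :=
      ψ.injective
    have h2 := (Submodule.equivMapOfInjective _ hinj (diagonalImageMul (lam w) (ψ.symm Q)))
    rw [← h1] at h2
    exact h2.symm.finiteDimensional

end CuntzAlgebra

end

theorem proposition5p1 :
    (∀ n : ℕ, 2 ≤ n →
      (∃ u ∈ CuntzAlgebra.wordUnitaries n,
        CuntzAlgebra.lam u ∉ CuntzAlgebra.autMulLamCore n) ∧
      (∀ w : unitary (CuntzAlgebra n), (w : CuntzAlgebra n) ∈ CuntzAlgebra.core n →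
        ∀ Q : CuntzAlgebra n, IsStarProjection Q → Q ≠ 0 →
          ¬ FiniteDimensional ℂ (CuntzAlgebra.diagonalImageMul (CuntzAlgebra.lam w) Q))) ∧
    (∃ u ∈ CuntzAlgebra.wordUnitaries 2,
      Module.finrank ℂ
        (CuntzAlgebra.diagonalImageMul (CuntzAlgebra.lam u) (CuntzAlgebra.proj [1])) = 1) := by
  refine ⟨fun n hn => ⟨?_, fun w hw Q hQ hQ0 =>
    CuntzAlgebra.not_finiteDimensional_diagonalImageMul_lam hn hw hQ hQ0⟩, ?_⟩
  · have h : (⟨0, by omega⟩ : Fin n) ≠ ⟨1, by omega⟩ := by simp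
    have hfin := Module.finite_of_finrank_eq_succ
      (CuntzAlgebra.finrank_diagonalImageMul_lam_swapUnitary h)
    exact ⟨_, CuntzAlgebra.swapUnitary_mem_wordUnitaries h, CuntzAlgebra.lam_notMem_autMulLamCore hn
      (CuntzAlgebra.isStarProjection_proj [⟨1, hn⟩])
      (CuntzAlgebra.proj_ne_zero (by omega) [⟨1, hn⟩])⟩
  -- Letters start at 0, so b = 1 is the second letter and `proj [1]` is P₂.
  · have h : (0 : Fin 2) ≠ 1 := by decide
    exact ⟨_, CuntzAlgebra.swapUnitary_mem_wordUnitaries h,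
      CuntzAlgebra.finrank_diagonalImageMul_lam_swapUnitary h⟩
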